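/- Let $M$ be a smooth manifold of dimension $n\ge 1$. A Finsler metric on $M$ is a continuous function $F\colon TM\to[0,\infty)$ that is $C^2$ off the zero section, positively homogeneous of degree $1$ on each fibre, vanishes exactly on the zero section, and for which the Hessian of $v\mapsto F(x,v)^2$ is positive definite at every $v\neq 0$; it is reversible if $F(x,-v)=F(x,v)$. Its dual metric is $F^*(x,l)=\sup\{l(v)\mid F(x,v)=1\}$ for $l\in T_x^*M$. Let $HM=(TM\smallsetminus 0)/\mathbb R^+$, with projection $\pi\colon HM\to M$ and fibres $H_xM$. The Hilbert form of $F$ is the $1$-form on $HM$ given by $A_{(x,\xi)}(Z)=\lim_{\varepsilon\to0}\varepsilon^{-1}\bigl(F(x,v+\varepsilon\,d\pi(Z))-F(x,v)\bigr)$, where $v$ is any vector of direction $\xi$; the geodesic vector field $X$ of $F$ is the vector field on $HM$ determined by $A(X)=1$ and $i_X\,dA=0$. The angle measure $\alpha^F$ is the family of measures on the fibres $H_xM$ determined by $\alpha^F\wedge\pi^*\Omega^F=A\wedge (dA)^{n-1}$ for some volume form (density) $\Omega^F$ on $M$, together with $\int_{H_xM}\alpha^F=\mathrm{vol}(S^{n-1})$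 for every $x$, where $\mathrm{vol}(S^{n-1})$ is the Euclidean volume of the unit sphere. The Bourguignon--Foulon (BF) Laplacian of $F$ is $$\Delta^Ff(x)=\frac{n}{\mathrm{vol}(S^{n-1})}\int_{H_xM}L_X^2(\pi^*f)\,\alpha^F ,$$ and its symbol metric $\sigma^F$ is the symmetric bilinear form on each $T_x^*M$ such that $\langle d_x\varphi,d_x\psi\rangle_{\sigma^F}=\tfrac12\Delta^F(\varphi\psi)(x)$ for all $C^2$ functions $\varphi,\psi$ that vanish at $x$; write $\|l\|_{\sigma^F}=\sqrt{\langle l,l\rangle_{\sigma^F}}$. Let $\bar F$ be a reversible Finsler metric on $M$, let $\beta$ be a $1$-form of class $C^2$ on $M$ with $\bar F^*(x,\beta_x)<1$ for all $x\in M$, and let $F=\bar F+\beta$. Let $\sigma$ and $\bar\sigma$ be the symbol metrics of the BF-Laplacians of $F$ and $\bar F$, and let $\bar X$ and $\bar\alpha$ be the geodesic vector field and the angle measure of $\bar F$. Then, for every $f\in C^1(M)$ and every $x\in M$, $$\|d_xf\|_{\sigma}\ \ge\ \|d_xf\|_{\bar\sigma},$$ with equality if and only if $d_xf=0$ or $\beta_x=0$.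 Moreover, if $\beta_x\neq0$ and $H_x^+M=\{\xi\in H_xM\mid \pi^*\beta(\bar X)(x,\xi)\ge0\}$, then $$\|d_xf\|_\sigma^2=\frac{2n}{\mathrm{vol}(S^{n-1})}\int_{H_x^+M}\frac{(L_{\bar X}\pi^*f)^2}{1-(\pi^*\beta(\bar X))^2}\,\bar\alpha .$$ -/

import Mathlib

open scoped Manifold ContDiff
open MeasureTheory Bundle

noncomputable section

namespace BF

/-! Manifolds have dimension `m + 1 ≥ 1`; the model space is `EuclideanSpace ℝ (Fin (m + 1))`. -/

/-- The model space `ℝ^(m+1)`. -/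
abbrev Model (m : ℕ) := EuclideanSpace ℝ (Fin (m + 1))

/-- The volume of the Euclidean unit sphere `S^m` in `ℝ^(m+1)`. -/
def sphereVol (m : ℕ) : ENNReal :=
  (volume : Measure (Model m)).toSphere Set.univ

variable {m : ℕ} {M : Type*} [TopologicalSpace M] [ChartedSpace (Model m) M]
  [IsManifold (𝓡 (m + 1)) ∞ M]

section Finsler

/-- A Finsler metric: continuous on `TM`, `C²` off the zero section, positively homogeneous,
positive definite and strongly convex. The last condition says that the second derivative of
`F_x²` at `v ≠ 0` is a positive definite quadratic form: its value at `w` is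
`d²/dt² F(x, v + t w)²` at `t = 0`. -/
structure IsFinslerMetric (F : TangentBundle (𝓡 (m + 1)) M → ℝ) : Prop where
  continuous : Continuous F
  contMDiffOn : ContMDiffOn (𝓡 (m + 1)).tangent 𝓘(ℝ, ℝ) 2 F {p | p.2 ≠ 0}
  homogeneous : ∀ (x : M) (v : TangentSpace (𝓡 (m + 1)) x) (c : ℝ), 0 < c →
    F ⟨x, c • v⟩ = c * F ⟨x, v⟩
  nonneg : ∀ p, 0 ≤ F p
  eq_zero_iff : ∀ p : TangentBundle (𝓡 (m + 1)) M, F p = 0 ↔ p.2 = 0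
  stronglyConvex : ∀ (x : M) (v w : TangentSpace (𝓡 (m + 1)) x), v ≠ 0 → w ≠ 0 →
    0 < iteratedDeriv 2 (fun t : ℝ => F ⟨x, v + t • w⟩ ^ 2) 0

/-- Reversibility: `F(x, -v) = F(x, v)`. -/
def IsReversible (F : TangentBundle (𝓡 (m + 1)) M → ℝ) : Prop :=
  ∀ (x : M) (v : TangentSpace (𝓡 (m + 1)) x), F ⟨x, -v⟩ = F ⟨x, v⟩

/-- The dual metric `F*(x, l) = sup {l(v) | F(x, v) = 1}`. -/
def dualMetric (F : TangentBundle (𝓡 (m + 1)) M → ℝ) (x : M)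
    (l : TangentSpace (𝓡 (m + 1)) x →L[ℝ] ℝ) : ℝ :=
  sSup {r | ∃ v : TangentSpace (𝓡 (m + 1)) x, F ⟨x, v⟩ = 1 ∧ l v = r}

/-- A one-form is of class `C²` if it is so as a (fibrewise linear) function on `TM`. -/
def IsC2OneForm (β : ∀ x : M, TangentSpace (𝓡 (m + 1)) x →L[ℝ] ℝ) : Prop :=
  ContMDiff (𝓡 (m + 1)).tangent 𝓘(ℝ, ℝ) 2
    (fun p : TangentBundle (𝓡 (m + 1)) M => β p.1 p.2)

/-- The function `F + β` on `TM`. -/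
def addOneForm (F : TangentBundle (𝓡 (m + 1)) M → ℝ)
    (β : ∀ x : M, TangentSpace (𝓡 (m + 1)) x →L[ℝ] ℝ) : TangentBundle (𝓡 (m + 1)) M → ℝ :=
  fun p => F p + β p.1 p.2

end Finsler

section ExteriorDerivative

/-- The exterior derivative at `p` of a one-form `θ` on a manifold without boundary, computed in
the preferred chart at `p` (which is also the chart that identifies `T_pN` with the model vector
space): `dθ(Z, W) = D_Z(θ̂ W) - D_W(θ̂ Z)`, where `θ̂` is the pull-back of `θ` by the inverse of
the chart and `Z`, `W` are extended as constant vector fields. -/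
def extDerivOneForm {V H N : Type*} [NormedAddCommGroup V] [NormedSpace ℝ V]
    [TopologicalSpace H] (J : ModelWithCorners ℝ V H) [TopologicalSpace N] [ChartedSpace H N]
    (θ : ∀ p : N, TangentSpace J p → ℝ) (p : N) (Z W : TangentSpace J p) : ℝ :=
  let loc : V → V → ℝ := fun q U =>
    θ ((extChartAt J p).symm q) (mfderiv 𝓘(ℝ, V) J (extChartAt J p).symm q U)
  let q₀ : V := extChartAt J p p
  fderiv ℝ (fun q => loc q W) q₀ Z - fderiv ℝ (fun q => loc q Z) q₀ W

end ExteriorDerivative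

section Contact

/-! Objects on the homogenized bundle `HM = (TM ∖ 0)/ℝ⁺` are described by their lifts to the slit
tangent bundle `TM ∖ 0` under the projection `r : TM ∖ 0 → HM`: functions on `HM` are functions on
`TM ∖ 0` that are homogeneous of degree `0`, forms are replaced by their pull-backs. -/

/-- The differential of the projection `π : TM → M`. -/
def dproj (p : TangentBundle (𝓡 (m + 1)) M) :
    TangentSpace (𝓡 (m + 1)).tangent p →L[ℝ] TangentSpace (𝓡 (m + 1)) p.1 :=
  mfderiv (𝓡 (m + 1)).tangent (𝓡 (m + 1))
    (fun q : TangentBundle (𝓡 (m + 1)) M => q.1) p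

/-- The Hilbert form `A_(x,v)(Z) = lim (F(x, v + ε dπ(Z)) - F(x, v)) / ε`. -/
def hilbertForm (F : TangentBundle (𝓡 (m + 1)) M → ℝ) (p : TangentBundle (𝓡 (m + 1)) M)
    (Z : TangentSpace (𝓡 (m + 1)).tangent p) : ℝ :=
  deriv (fun ε : ℝ => F ⟨p.1, p.2 + ε • dproj p Z⟩) 0

/-- The exterior derivative `dA` of the Hilbert form. -/
def dHilbertForm (F : TangentBundle (𝓡 (m + 1)) M → ℝ) (p : TangentBundle (𝓡 (m + 1)) M)
    (Z W : TangentSpace (𝓡 (m + 1)).tangent p) : ℝ :=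
  extDerivOneForm (𝓡 (m + 1)).tangent (hilbertForm F) p Z W

/-- `Z` is the value at `p` of the geodesic vector field, i.e. of the Reeb field of `A`:
`A(Z) = 1` and `i_Z dA = 0`. These two conditions determine the projection of `Z` to `HM`; the
condition `dF(Z) = 0` (tangency to the level sets of `F`, which are copies of `HM`) fixes the lift
of that vector to `TM ∖ 0`. -/
def IsGeodesicVector (F : TangentBundle (𝓡 (m + 1)) M → ℝ) (p : TangentBundle (𝓡 (m + 1)) M)
    (Z : TangentSpace (𝓡 (m + 1)).tangent p) : Prop :=
  hilbertForm F p Z = 1 ∧ (∀ W, dHilbertForm F p Z W = 0) ∧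
    mfderiv (𝓡 (m + 1)).tangent 𝓘(ℝ, ℝ) F p Z = 0

/-- The geodesic vector field `X` of `F`. -/
def geodesicField (F : TangentBundle (𝓡 (m + 1)) M → ℝ) (p : TangentBundle (𝓡 (m + 1)) M) :
    TangentSpace (𝓡 (m + 1)).tangent p :=
  Classical.epsilon (IsGeodesicVector F p)

/-- The derivative `L_X g` along the geodesic vector field of `F`. -/
def lieX (F g : TangentBundle (𝓡 (m + 1)) M → ℝ) : TangentBundle (𝓡 (m + 1)) M → ℝ :=
  fun p => mfderiv (𝓡 (m + 1)).tangent 𝓘(ℝ, ℝ) g p (geodesicField F p)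

/-- The pull-back `π^* f` of a function on `M`. -/
def pull (f : M → ℝ) : TangentBundle (𝓡 (m + 1)) M → ℝ := fun p => f p.1

/-- The function `π^*β(X)`, for a one-form `β` on `M`. -/
def oneFormX (F : TangentBundle (𝓡 (m + 1)) M → ℝ)
    (β : ∀ x : M, TangentSpace (𝓡 (m + 1)) x →L[ℝ] ℝ) : TangentBundle (𝓡 (m + 1)) M → ℝ :=
  fun p => β p.1 (dproj p (geodesicField F p))

/-- The contact volume `A ∧ (dA)^m`, a form of degree `2 m + 1`. Its arguments are indexed by
`Option (Fin m × Fin 2)`, in the order `none, (0,0), (0,1), (1,0), (1,1), …`. -/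
def contactVolume (F : TangentBundle (𝓡 (m + 1)) M → ℝ) (p : TangentBundle (𝓡 (m + 1)) M)
    (Z : Option (Fin m × Fin 2) → TangentSpace (𝓡 (m + 1)).tangent p) : ℝ :=
  (2 ^ m)⁻¹ * ∑ τ : Equiv.Perm (Option (Fin m × Fin 2)),
    ((Equiv.Perm.sign τ : ℤ) : ℝ) * (hilbertForm F p (Z (τ none)) *
      ∏ i : Fin m, dHilbertForm F p (Z (τ (some (i, 0)))) (Z (τ (some (i, 1)))))

end Contact

section Angle

/-- The fibre `H_xM = (T_xM ∖ 0)/ℝ⁺` of the homogenized bundle. -/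
def HFiber (m : ℕ) {M : Type*} [TopologicalSpace M] [ChartedSpace (Model m) M] (x : M) : Type :=
  Module.Ray ℝ (TangentSpace (𝓡 (m + 1)) x)

/-- A nonzero vector that projects to the direction `ξ`. -/
def HFiber.vec {x : M} (ξ : HFiber m x) : TangentSpace (𝓡 (m + 1)) x :=
  Module.Ray.someVector (R := ℝ) (M := TangentSpace (𝓡 (m + 1)) x) ξ

/-- The value at `ξ ∈ H_xM` of a function on `HM`, given by its lift `g` to `TM ∖ 0`. -/
def HFiber.val {x : M} (g : TangentBundle (𝓡 (m + 1)) M → ℝ) (ξ : HFiber m x) : ℝ :=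
  g ⟨x, ξ.vec⟩

/-- The direction of a coordinate unit vector; this is a homeomorphism of the Euclidean unit sphere
(in the preferred chart at `x`) with `H_xM`. -/
def direction (x : M) (u : Metric.sphere (0 : Model m) 1) : HFiber m x :=
  rayOfNeZero ℝ (M := TangentSpace (𝓡 (m + 1)) x) (u : Model m) (ne_zero_of_mem_unit_sphere u)

/-- The Borel `σ`-algebra of `H_xM`, transported from the unit sphere. -/
instance (x : M) : MeasurableSpace (HFiber m x) :=
  MeasurableSpace.map (direction x) inferInstance

/-- An orthonormal basis of the tangent space at `u` of the Euclidean unit sphere. -/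
def sphereFrame (u : Metric.sphere (0 : Model m) 1) (i : Fin m) : Model m :=
  haveI : Fact (Module.finrank ℝ (Model m) = m + 1) := ⟨finrank_euclideanSpace_fin⟩
  (OrthonormalBasis.fromOrthogonalSpanSingleton (𝕜 := ℝ) m (ne_zero_of_mem_unit_sphere u) i :
    Model m)

/-- Tangent vectors of `TM` at `(x, u)`, written in the coordinates `(base, fibre)` of the chart of
`TM` induced by the preferred chart at `x`: the vertical vectors `(0, Y_i)`, where `(Y_i)` is an
orthonormal frame of the unit sphere at `u`, and the lifts `(e_j, 0)` of the coordinate basis of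
`T_xM`. -/
def splitFrame (x : M) (u : Metric.sphere (0 : Model m) 1) :
    Option (Fin m × Fin 2) →
      TangentSpace (𝓡 (m + 1)).tangent (⟨x, (u : Model m)⟩ : TangentBundle (𝓡 (m + 1)) M)
  | none => ((EuclideanSpace.single 0 1 : Model m), (0 : Model m))
  | some (i, 0) => ((0 : Model m), sphereFrame u i)
  | some (i, 1) => ((EuclideanSpace.single i.succ 1 : Model m), (0 : Model m))

/-- The measure on `H_xM` of the density `|α₀|`, where the form `α₀` along the fibre is determined
by `α₀ ∧ π^*Ω₀ = A ∧ (dA)^m` for the coordinate volume `Ω₀ = dx⁰ ∧ … ∧ dxᵐ` at `x`. It is computed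
by parametrizing `H_xM` by the unit sphere with its surface measure. -/
def verticalMeasure (F : TangentBundle (𝓡 (m + 1)) M → ℝ) (x : M) : Measure (HFiber m x) :=
  Measure.map (direction x)
    ((volume : Measure (Model m)).toSphere.withDensity
      (fun u => ENNReal.ofReal |contactVolume F ⟨x, (u : Model m)⟩ (splitFrame x u)|))

/-- The angle measure `α^F` on `H_xM`: a volume form `Ω` at `x` is a multiple `c Ω₀` of `Ω₀`, so
`α ∧ π^*Ω = A ∧ (dA)^m` gives `α = c⁻¹ α₀`, and `c` is determined by the condition that the total
mass is the volume of the Euclidean unit sphere `S^m`. -/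
def angleMeasure (F : TangentBundle (𝓡 (m + 1)) M → ℝ) (x : M) : Measure (HFiber m x) :=
  (sphereVol m / verticalMeasure F x Set.univ) • verticalMeasure F x

end Angle

section Laplacian

/-- The Bourguignon--Foulon Laplacian
`Δ^F f (x) = n / vol(S^(n-1)) ∫_(H_xM) L_X²(π^* f) α^F`, with `n = m + 1`. -/
def bfLaplacian (F : TangentBundle (𝓡 (m + 1)) M → ℝ) (f : M → ℝ) (x : M) : ℝ :=
  ((m : ℝ) + 1) / (sphereVol m).toReal *
    ∫ ξ : HFiber m x, ξ.val (lieX F (lieX F (pull f))) ∂(angleMeasure F x)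

/-- The coordinate function at `x` with differential `l` at `x` and value `0` at `x`. -/
def coordFun (x : M) (l : TangentSpace (𝓡 (m + 1)) x →L[ℝ] ℝ) (y : M) : ℝ :=
  l (extChartAt (𝓡 (m + 1)) x y - extChartAt (𝓡 (m + 1)) x x : Model m)

/-- The principal symbol (as a bilinear form on covectors) of a second order linear differential
operator `P` on functions: `σ_x(l₁, l₂) = P(φ₁ φ₂)(x) / 2` for functions `φ₁`, `φ₂` that vanish at
`x` and have differentials `l₁`, `l₂` there. -/
def principalSymbol (P : (M → ℝ) → M → ℝ) (x : M)
    (l₁ l₂ : TangentSpace (𝓡 (m + 1)) x →L[ℝ] ℝ) : ℝ :=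
  (1 / 2 : ℝ) * P (fun y => coordFun x l₁ y * coordFun x l₂ y) x

/-- The norm `‖l‖_σ` of a covector for the symbol metric `σ` of the Laplacian of `F`. -/
def symbolNorm (F : TangentBundle (𝓡 (m + 1)) M → ℝ) (x : M)
    (l : TangentSpace (𝓡 (m + 1)) x →L[ℝ] ℝ) : ℝ :=
  Real.sqrt (principalSymbol (bfLaplacian F) x l l)

end Laplacian

end BF

end

/-! Everything happens on a single fibre. The geodesic vector at `(x, v)` projects to `v / F(v)`.
For `φ` vanishing at `x` with differential `l`, this gives `L_X²(φ²) = 2 (l(v) / F(v))²` over `x`,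
because the factors that vanish at `x` remove every other term
(`IsFinslerMetric.lieX_lieX_pull_coordFun`). So the symbol is the mean of `n (l / F)²` for the angle
measure.

Parametrize the fibre by the Euclidean unit sphere. Vertical vectors are isotropic for `dA` and lie
in the kernel of `A`, so `A ∧ (dA)^m` reduces to one determinant, and the density of the angle
measure is a constant times `F(u) ρ(u)`, where `ρ(u) = m! |det(Hess F + u uᵀ)|`
(`abs_contactVolume_splitFrame`). A one-form is linear on fibres, hence `F̄` and `F̄ + β` have the
same Hessian and the same `ρ`. By reversibility `ρ` is even. Then `∫ β ρ = 0`, the total masses `K`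
of the two densities agree, and `‖l‖_σ² = (n / K) ∫ ρ l² / (F̄ + β)`.

Averaging the integrand over `u` and `-u` turns it into `ρ l² F̄ / (F̄² - β²)`
(`principalSymbol_addOneForm`). It exceeds the integrand `ρ l² / F̄` of `‖l‖_σ̄²` by `ρ (l β)² / (F̄
(F̄² - β²)) ≥ 0`. By continuity the integral of this excess vanishes only if `l β = 0` on the whole
sphere, that is, if one of the two linear forms is zero (`principalSymbol_sub`). The averaged
integrand is even and the equator `β = 0` is a null set, so twice the integral over a hemisphere
gives the explicit formula (`integral_halfFiber`). -/

noncomputable section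

namespace BF

/-! ### Evaluation of `A ∧ (dA)^m` on a frame with an isotropic half -/

section Combinatorics

open Equiv

variable {ι : Type*}

/-- If a permutation of the slots of `A ∧ (dA)^m` puts no vertical vector into both slots of a
factor `dA` and none into `A`, then every factor `dA` gets a vertical vector. -/
theorem exists_vertical_of_perm [Finite ι] (τ : Perm (Option (ι × Fin 2)))
    (h0 : ∀ j, τ none ≠ some (j, 0))
    (h2 : ∀ i j k, ¬ (τ (some (i, 0)) = some (j, 0) ∧ τ (some (i, 1)) = some (k, 0))) (i : ι) :
    ∃ j, τ (some (i, 0)) = some (j, 0) ∨ τ (some (i, 1)) = some (j, 0) := by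
  -- Pigeonhole: each vertical vector sits in some factor `dA`, distinct ones in distinct factors,
  -- and there are as many factors as vertical vectors.
  have hex : ∀ j : ι, ∃ (i : ι) (k : Fin 2), τ (some (i, k)) = some (j, 0) := by
    intro j
    rcases hc : τ.symm (some (j, 0)) with _ | ⟨i, k⟩
    · exact absurd (by rw [← hc]; simp) (h0 j)
    · exact ⟨i, k, by rw [← hc]; simp⟩
  choose f k hf using hex
  have hinj : Function.Injective f := by
    intro j j' hjj
    have h1 := hf j
    have h1' := hf j'
    rw [← hjj] at h1'
    by_cases hk : k j = k j'
    · rw [← hk, h1] at h1'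
      simpa using h1'
    · exfalso
      rcases (by omega : k j = 0 ∨ k j = 1) with hkj | hkj <;>
      rcases (by omega : k j' = 0 ∨ k j' = 1) with hkj' | hkj'
      · exact hk (hkj.trans hkj'.symm)
      · rw [hkj] at h1; rw [hkj'] at h1'; exact h2 _ _ _ ⟨h1, h1'⟩
      · rw [hkj] at h1; rw [hkj'] at h1'; exact h2 _ _ _ ⟨h1', h1⟩
      · exact hk (hkj.trans hkj'.symm)
  obtain ⟨j, rfl⟩ := (Finite.injective_iff_surjective.mp hinj) i
  refine ⟨j, ?_⟩
  have := hf j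
  rcases (by omega : k j = 0 ∨ k j = 1) with hkj | hkj <;> rw [hkj] at this
  · exact Or.inl this
  · exact Or.inr this

/-- The slots of the contact volume, split into vertical and horizontal ones. -/
def slotEquiv : ι ⊕ Option ι ≃ Option (ι × Fin 2) where
  toFun := Sum.elim (fun i => some (i, 0)) (fun o => o.map fun i => (i, 1))
  invFun := fun o => match o with
    | none => Sum.inr none
    | some (i, 0) => Sum.inl i
    | some (i, 1) => Sum.inr (some i)
  left_inv := by rintro (i | _ | i) <;> rfl
  right_inv := by
    rintro (_ | ⟨i, k⟩)
    · rfl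
    · fin_cases k <;> rfl

/-- The part of a two-form that pairs a vertical slot with a horizontal one. -/
def mixedPart (w : Option (ι × Fin 2) → Option (ι × Fin 2) → ℝ)
    (p q : Option (ι × Fin 2)) : ℝ :=
  open Classical in
  if (∃ i, p = some (i, 0)) ∧ ¬ ∃ i, q = some (i, 0) then w p q else 0

variable [Fintype ι]

/-- A term with a vertical vector in `a`, or with two of them in one factor, is zero on both sides.
In all other terms each factor holds exactly one vertical vector, in its first or second slot, and
antisymmetry of `w` accounts for the sign. -/
theorem mul_prod_eq_mul_prod_mixedPart (a : Option (ι × Fin 2) → ℝ)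
    (w : Option (ι × Fin 2) → Option (ι × Fin 2) → ℝ) (ha : ∀ i, a (some (i, 0)) = 0)
    (hw0 : ∀ i j, w (some (i, 0)) (some (j, 0)) = 0) (hw : ∀ p q, w p q = -w q p)
    (τ : Perm (Option (ι × Fin 2))) :
    a (τ none) * ∏ i, w (τ (some (i, 0))) (τ (some (i, 1))) =
      a (τ none) * ∏ i, (mixedPart w (τ (some (i, 0))) (τ (some (i, 1))) -
        mixedPart w (τ (some (i, 1))) (τ (some (i, 0)))) := by
  by_cases h0 : ∃ j, τ none = some (j, 0)
  · obtain ⟨j, hj⟩ := h0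
    simp [hj, ha]
  by_cases h2 : ∃ i j k, τ (some (i, 0)) = some (j, 0) ∧ τ (some (i, 1)) = some (k, 0)
  · obtain ⟨i, j, k, h1, h2⟩ := h2
    rw [Finset.prod_eq_zero (Finset.mem_univ i), Finset.prod_eq_zero (Finset.mem_univ i)]
    · simp [mixedPart, h1, h2]
    · rw [h1, h2, hw0]
  push Not at h0
  have h2' : ∀ i j k, ¬ (τ (some (i, 0)) = some (j, 0) ∧ τ (some (i, 1)) = some (k, 0)) :=
    fun i j k h => h2 ⟨i, j, k, h⟩
  congr 1
  refine Finset.prod_congr rfl fun i _ => ?_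
  obtain ⟨j, hj | hj⟩ := exists_vertical_of_perm τ h0 h2' i
  · have : ¬ ∃ k, τ (some (i, 1)) = some (k, 0) := fun ⟨k, hk⟩ => h2' i j k ⟨hj, hk⟩
    simp only [mixedPart]
    rw [if_pos ⟨⟨j, hj⟩, this⟩, if_neg (fun h => this h.1), sub_zero]
  · have : ¬ ∃ k, τ (some (i, 0)) = some (k, 0) := fun ⟨k, hk⟩ => h2' i k j ⟨hk, hj⟩
    simp only [mixedPart]
    rw [if_neg (fun h => this h.1), if_pos ⟨⟨j, hj⟩, this⟩, zero_sub, hw]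

variable [DecidableEq ι]

/-- Expanding the product gives one term for each choice of swaps inside the pairs. A swap changes
both the sign of the term and the sign of `τ`, so reindexing `τ` makes all these terms contribute
equally. -/
theorem sum_perm_prod_sub (a : Option (ι × Fin 2) → ℝ)
    (η : Option (ι × Fin 2) → Option (ι × Fin 2) → ℝ) :
    ∑ τ : Perm (Option (ι × Fin 2)), ((Perm.sign τ : ℤ) : ℝ) * (a (τ none) *
      ∏ i, (η (τ (some (i, 0))) (τ (some (i, 1))) - η (τ (some (i, 1))) (τ (some (i, 0))))) =
    2 ^ Fintype.card ι * ∑ τ : Perm (Option (ι × Fin 2)), ((Perm.sign τ : ℤ) : ℝ) * (a (τ none) *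
      ∏ i, η (τ (some (i, 0))) (τ (some (i, 1)))) := by
  have hsub : ∀ (τ : Perm (Option (ι × Fin 2))) (i : ι),
      η (τ (some (i, 0))) (τ (some (i, 1))) - η (τ (some (i, 1))) (τ (some (i, 0))) =
      ∑ s : Perm (Fin 2), ((Perm.sign s : ℤ) : ℝ) *
        η (τ (some (i, s 0))) (τ (some (i, s 1))) := by
    intro τ i
    have : (Finset.univ : Finset (Perm (Fin 2))) = {1, swap 0 1} := by decide
    rw [this, Finset.sum_pair (by decide)]
    simp
    ring
  simp_rw [hsub, Finset.prod_univ_sum, Finset.mul_sum, Fintype.piFinset_univ]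
  rw [Finset.sum_comm]
  have hs : ∀ s : ι → Perm (Fin 2), ∑ τ : Perm (Option (ι × Fin 2)), ((Perm.sign τ : ℤ) : ℝ) *
      (a (τ none) * ∏ i, ((Perm.sign (s i) : ℤ) : ℝ) *
        η (τ (some (i, s i 0))) (τ (some (i, s i 1))))
      = ∑ τ : Perm (Option (ι × Fin 2)), ((Perm.sign τ : ℤ) : ℝ) * (a (τ none) *
      ∏ i, η (τ (some (i, 0))) (τ (some (i, 1)))) := by
    intro s
    refine Fintype.sum_equiv (Equiv.mulRight (optionCongr (prodCongrRight s))) _ _ fun τ => ?_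
    have hsg : ((Perm.sign (τ * optionCongr (prodCongrRight s)) : ℤ) : ℝ) =
        ((Perm.sign τ : ℤ) : ℝ) * ∏ i, ((Perm.sign (s i) : ℤ) : ℝ) := by
      rw [Perm.sign_mul, optionCongr_sign, Perm.sign_prodCongrRight]
      simp [Units.coe_prod]
    rw [Equiv.coe_mulRight, hsg, Finset.prod_mul_distrib]
    simp only [Perm.mul_apply, optionCongr_apply, Option.map_none, Option.map_some,
      prodCongrRight_apply]
    ring
  rw [Finset.sum_congr rfl fun s _ => hs s, Finset.sum_const, Finset.card_univ, Fintype.card_pi,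
    Finset.prod_const, Fintype.card_perm, Fintype.card_fin, nsmul_eq_mul, Finset.card_univ]
  simp [Finset.mul_sum]

/-- Only permutations preserving the splitting into vertical and horizontal slots survive. Such a
permutation is a pair `(κ, ρ)`, and its term depends only on `ρ κ⁻¹`: each of the factorially many
`κ` yields one full Leibniz expansion of the determinant. -/
theorem sum_perm_prod_mixedPart (a : Option (ι × Fin 2) → ℝ)
    (w : Option (ι × Fin 2) → Option (ι × Fin 2) → ℝ) :
    ∑ τ : Perm (Option (ι × Fin 2)), ((Perm.sign τ : ℤ) : ℝ) * (a (τ none) *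
      ∏ i, mixedPart w (τ (some (i, 0))) (τ (some (i, 1)))) =
    (Fintype.card ι).factorial *
      (Matrix.of fun (r c : Option ι) => r.elim (a (slotEquiv (Sum.inr c)))
        (fun i => w (some (i, 0)) (slotEquiv (Sum.inr c)))).det := by
  classical
  set N : Matrix (Option ι) (Option ι) ℝ := Matrix.of fun (r c : Option ι) =>
    r.elim (a (slotEquiv (Sum.inr c))) (fun i => w (some (i, 0)) (slotEquiv (Sum.inr c))) with hN
  set T : Perm (Option (ι × Fin 2)) → ℝ := fun τ => ((Perm.sign τ : ℤ) : ℝ) * (a (τ none) *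
      ∏ i, mixedPart w (τ (some (i, 0))) (τ (some (i, 1)))) with hT
  have hnv : ∀ c : Option ι, ¬ ∃ i : ι, slotEquiv (Sum.inr c) = some (i, (0 : Fin 2)) := by
    rintro (_ | c) ⟨i, hi⟩ <;> simp [slotEquiv] at hi
  have hterm : ∀ (κ : Perm ι) (ρ : Perm (Option ι)),
      T (slotEquiv.permCongr (Perm.sumCongr κ ρ)) =
        ((Perm.sign (ρ * (optionCongr κ)⁻¹) : ℤ) : ℝ) *
          ∏ r, N r ((ρ * (optionCongr κ)⁻¹) r) := by
    intro κ ρ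
    have e1 : (slotEquiv.permCongr (Perm.sumCongr κ ρ)) none = slotEquiv (Sum.inr (ρ none)) := rfl
    have e2 : ∀ i, (slotEquiv.permCongr (Perm.sumCongr κ ρ)) (some (i, 0)) = some (κ i, 0) :=
      fun i => rfl
    have e3 : ∀ i, (slotEquiv.permCongr (Perm.sumCongr κ ρ)) (some (i, 1)) =
        slotEquiv (Sum.inr (ρ (some i))) := fun i => rfl
    have e4 : ∀ i k, mixedPart w (some (i, 0)) (slotEquiv (Sum.inr k)) = N (some i) k := by
      intro i k
      rw [mixedPart, if_pos ⟨⟨i, rfl⟩, hnv k⟩]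
      rfl
    simp only [hT, e1, e2, e3, e4]
    rw [Perm.sign_permCongr, Perm.sign_sumCongr, Perm.sign_mul, Perm.sign_inv, optionCongr_sign,
      mul_comm (Perm.sign κ), Fintype.prod_option]
    have hinv : ∀ o, (optionCongr κ)⁻¹ (o.map κ) = o := fun o => by
      rw [Perm.inv_eq_iff_eq]; rfl
    have h1 : (ρ * (optionCongr κ)⁻¹) none = ρ none := congrArg ρ (hinv none)
    have h2 : ∀ i, (ρ * (optionCongr κ)⁻¹) (some (κ i)) = ρ (some i) :=
      fun i => congrArg ρ (hinv (some i))
    rw [h1, ← Equiv.prod_comp κ (fun i => N (some i) ((ρ * (optionCongr κ)⁻¹) (some i)))]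
    simp only [h2]
    rfl
  have hsum : ∑ τ, T τ = ∑ κρ : Perm ι × Perm (Option ι),
      T (slotEquiv.permCongr (Perm.sumCongr κρ.1 κρ.2)) := by
    rw [← Equiv.sum_comp (slotEquiv (ι := ι)).permCongr T]
    symm
    refine Finset.sum_of_injOn (fun κρ => Perm.sumCongr κρ.1 κρ.2) ?_ (by simp) ?_ (by simp)
    · rintro ⟨κ, ρ⟩ - ⟨κ', ρ'⟩ - h
      have h2 : ∀ x, Perm.sumCongr κ ρ x = Perm.sumCongr κ' ρ' x := DFunLike.congr_fun h
      simp only [Sum.map_inr, Sum.map_inl, Perm.sumCongr_apply, Sum.forall, Sum.inl.injEq,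
          Sum.inr.injEq] at h2
      ext1
      · exact Equiv.ext h2.1
      · exact Equiv.ext h2.2
    -- A permutation outside the image sends some vertical slot to a horizontal one, and the
    -- corresponding `mixedPart` factor is zero.
    · intro σ _ hσ
      have h1 : ¬∀ x, ∃ y, Sum.inl y = σ (Sum.inl x) := by
        intro hall
        have : σ ∈ (Perm.sumCongrHom ι (Option ι)).range := by
          apply Perm.mem_sumCongrHom_range_of_perm_mapsTo_inl
          rintro _ ⟨x, rfl⟩
          exact hall x
        obtain ⟨⟨κ, ρ⟩, h⟩ := this
        exact hσ ⟨(κ, ρ), by simp, h⟩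
      obtain ⟨i, hi⟩ := not_forall.mp h1
      simp only [hT]
      rw [Finset.prod_eq_zero (Finset.mem_univ i), mul_zero, mul_zero]
      rcases hx : σ (Sum.inl i) with j | c
      · exact absurd ⟨j, hx.symm⟩ hi
      · have e : slotEquiv.permCongr σ (some (i, 0)) = slotEquiv (Sum.inr c) := by
          rw [← hx]; rfl
        rw [e, mixedPart, if_neg (fun h => hnv c h.1)]
  rw [hsum, Fintype.sum_prod_type, Finset.sum_congr rfl fun κ _ => ?_, Finset.sum_const,
    Finset.card_univ, Fintype.card_perm, nsmul_eq_mul]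
  rw [Finset.sum_congr rfl fun ρ _ => hterm κ ρ, ← Matrix.det_transpose, Matrix.det_apply']
  exact Equiv.sum_comp (Equiv.mulRight (optionCongr κ)⁻¹)
      (fun ρ => ((Perm.sign ρ : ℤ) : ℝ) * ∏ r, N r (ρ r))

/-- Evaluation of `A ∧ (dA)^m` on a frame whose slots `(i, 0)` span an isotropic subspace that lies
in the kernel of `A`. -/
theorem sum_perm_contact (a : Option (ι × Fin 2) → ℝ)
    (w : Option (ι × Fin 2) → Option (ι × Fin 2) → ℝ) (ha : ∀ i, a (some (i, 0)) = 0)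
    (hw0 : ∀ i j, w (some (i, 0)) (some (j, 0)) = 0) (hw : ∀ p q, w p q = -w q p) :
    (2 ^ Fintype.card ι)⁻¹ * ∑ τ : Perm (Option (ι × Fin 2)), ((Perm.sign τ : ℤ) : ℝ) *
      (a (τ none) * ∏ i, w (τ (some (i, 0))) (τ (some (i, 1)))) =
    (Fintype.card ι).factorial *
      (Matrix.of fun (r c : Option ι) => r.elim (a (slotEquiv (Sum.inr c)))
        (fun i => w (some (i, 0)) (slotEquiv (Sum.inr c)))).det := by
  simp_rw [mul_prod_eq_mul_prod_mixedPart a w ha hw0 hw, sum_perm_prod_sub,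
    sum_perm_prod_mixedPart]
  rw [inv_mul_cancel_left₀ (by positivity)]

end Combinatorics

/-! ### Derivatives of homogeneous functions -/

section FibreCalculus

open Filter Topology

variable {E : Type*} [NormedAddCommGroup E] [NormedSpace ℝ E]

/-- Euler's identity for functions on a product that are homogeneous in the second variable. -/
theorem fderiv_apply_snd_of_homogeneous {E' : Type*} [NormedAddCommGroup E'] [NormedSpace ℝ E']
    {G : E' × E → ℝ} (hom : ∀ y w, ∀ c : ℝ, 0 < c → G (y, c • w) = c * G (y, w)) {q : E' × E}
    (hG : DifferentiableAt ℝ G q) : fderiv ℝ G q (0, q.2) = G q := by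
  have h1 : HasDerivAt (fun c : ℝ => (q.1, c • q.2)) (0, q.2) 1 := by
    simpa using (hasDerivAt_const (1 : ℝ) q.1).prodMk ((hasDerivAt_id (1 : ℝ)).smul_const q.2)
  have h2 : HasDerivAt (fun c : ℝ => G (q.1, c • q.2)) (fderiv ℝ G q (0, q.2)) 1 := by
    have : HasFDerivAt G (fderiv ℝ G q) (q.1, (1 : ℝ) • q.2) := by simpa using hG.hasFDerivAt
    exact this.comp_hasDerivAt (1 : ℝ) h1
  have h3 : HasDerivAt (fun c : ℝ => G (q.1, c • q.2)) (G q) 1 := by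
    have : HasDerivAt (fun c : ℝ => c * G q) (G q) 1 := by
      simpa using (hasDerivAt_id (1 : ℝ)).mul_const (G q)
    refine this.congr_of_eventuallyEq ?_
    filter_upwards [lt_mem_nhds (zero_lt_one' ℝ)] with c hc using hom _ _ c hc
  exact h2.unique h3

theorem eventually_differentiableAt_of_contDiffAt_two {V : Type*} [NormedAddCommGroup V]
    [NormedSpace ℝ V] {G : V → ℝ} {q : V} (hG : ContDiffAt ℝ 2 G q) :
    ∀ᶠ q' in 𝓝 q, DifferentiableAt ℝ G q' := by
  filter_upwards [hG.eventually (by simp)] with q' h using h.differentiableAt (by norm_num)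

theorem differentiableAt_fderiv_of_contDiffAt_two {V : Type*} [NormedAddCommGroup V]
    [NormedSpace ℝ V] {G : V → ℝ} {q : V} (hG : ContDiffAt ℝ 2 G q) :
    DifferentiableAt ℝ (fderiv ℝ G) q :=
  (hG.fderiv_right (m := 1) (by norm_num)).differentiableAt (by norm_num)

theorem hessian_symm {V : Type*} [NormedAddCommGroup V]
    [NormedSpace ℝ V] {G : V → ℝ} {q : V} (hG : ContDiffAt ℝ 2 G q) (Z W : V) :
    fderiv ℝ (fderiv ℝ G) q Z W = fderiv ℝ (fderiv ℝ G) q W Z :=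
  (hG.isSymmSndFDerivAt (by simp)).eq Z W

/-- The derivative of Euler's identity. -/
theorem hessian_apply_snd_of_homogeneous {E' : Type*} [NormedAddCommGroup E'] [NormedSpace ℝ E']
    {G : E' × E → ℝ} (hom : ∀ y w, ∀ c : ℝ, 0 < c → G (y, c • w) = c * G (y, w)) {q : E' × E}
    (hG : ContDiffAt ℝ 2 G q) (Z : E' × E) :
    fderiv ℝ (fderiv ℝ G) q Z (0, q.2) = fderiv ℝ G q (Z.1, 0) := by
  have h1 : HasFDerivAt (fun q' : E' × E => fderiv ℝ G q' (0, q'.2))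
      ((fderiv ℝ G q).comp ((ContinuousLinearMap.inr ℝ E' E).comp (ContinuousLinearMap.snd ℝ E' E))
        + (fderiv ℝ (fderiv ℝ G) q).flip (0, q.2)) q :=
    (differentiableAt_fderiv_of_contDiffAt_two hG).hasFDerivAt.clm_apply
      ((ContinuousLinearMap.inr ℝ E' E).comp (ContinuousLinearMap.snd ℝ E' E)).hasFDerivAt
  have h2 : HasFDerivAt (fun q' : E' × E => fderiv ℝ G q' (0, q'.2)) (fderiv ℝ G q) q := by
    refine (hG.differentiableAt (by norm_num)).hasFDerivAt.congr_of_eventuallyEq ?_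
    filter_upwards [eventually_differentiableAt_of_contDiffAt_two hG] with q' h using
      fderiv_apply_snd_of_homogeneous hom h
  have h3 := congrArg (fun L : E' × E →L[ℝ] ℝ => L Z) (h1.unique h2)
  simp only [add_apply, ContinuousLinearMap.comp_apply,
    ContinuousLinearMap.flip_apply, ContinuousLinearMap.inr_apply, ContinuousLinearMap.coe_snd']
    at h3
  have h4 : fderiv ℝ G q Z = fderiv ℝ G q (Z.1, 0) + fderiv ℝ G q (0, Z.2) := by
    rw [← map_add]; simp
  linarith

variable {Φ : E → ℝ} {v : E}

theorem fderiv_apply_self_of_homogeneous (hom : ∀ w, ∀ c : ℝ, 0 < c → Φ (c • w) = c * Φ w)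
    (hΦ : DifferentiableAt ℝ Φ v) : fderiv ℝ Φ v v = Φ v := by
  have h2 : DifferentiableAt ℝ (fun q : ℝ × E => Φ q.2) (0, v) := by
    exact DifferentiableAt.comp (0, v) (f := Prod.snd) hΦ differentiableAt_snd
  have h := fderiv_apply_snd_of_homogeneous (G := fun q : ℝ × E => Φ q.2) (q := (0, v))
    (fun _ w c hc => hom w c hc) h2
  have h3 : HasFDerivAt (fun q : ℝ × E => Φ q.2)
      ((fderiv ℝ Φ v).comp (ContinuousLinearMap.snd ℝ ℝ E)) (0, v) :=
    HasFDerivAt.comp (0, v) (f := Prod.snd) hΦ.hasFDerivAt hasFDerivAt_snd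
  rw [h3.fderiv] at h
  simpa using h

/-- Differentiating Euler's identity shows that the radial direction lies in the kernel of the
Hessian. -/
theorem hessian_apply_self_of_homogeneous (hom : ∀ w, ∀ c : ℝ, 0 < c → Φ (c • w) = c * Φ w)
    (hΦ : ContDiffAt ℝ 2 Φ v) (w : E) : fderiv ℝ (fderiv ℝ Φ) v w v = 0 := by
  have h1 : HasFDerivAt (fun q : E => fderiv ℝ Φ q q)
      ((fderiv ℝ Φ v).comp (ContinuousLinearMap.id ℝ E) + (fderiv ℝ (fderiv ℝ Φ) v).flip v) v :=
    (differentiableAt_fderiv_of_contDiffAt_two hΦ).hasFDerivAt.clm_apply (hasFDerivAt_id v)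
  have h2 : HasFDerivAt (fun q : E => fderiv ℝ Φ q q) (fderiv ℝ Φ v) v := by
    refine (hΦ.differentiableAt (by norm_num)).hasFDerivAt.congr_of_eventuallyEq ?_
    filter_upwards [eventually_differentiableAt_of_contDiffAt_two hΦ] with q' h using
      fderiv_apply_self_of_homogeneous hom h
  have h3 := congrArg (fun L : E →L[ℝ] ℝ => L w) (h1.unique h2)
  simpa using h3

/-- Translates the convexity condition of a Finsler metric, stated for `F²` along lines, into the
first and second derivatives of `F`. -/
theorem iteratedDeriv_two_sq_line (hΦ : ContDiffAt ℝ 2 Φ v) (w : E) :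
    iteratedDeriv 2 (fun t : ℝ => Φ (v + t • w) ^ 2) 0 =
      2 * ((fderiv ℝ Φ v w) ^ 2 + Φ v * fderiv ℝ (fderiv ℝ Φ) v w w) := by
  have hline : ∀ t : ℝ, HasDerivAt (fun t : ℝ => v + t • w) w t := fun t => by
    simpa using ((hasDerivAt_id t).smul_const w).const_add v
  have hcont : Tendsto (fun t : ℝ => v + t • w) (𝓝 0) (𝓝 v) := by
    simpa using (hline 0).continuousAt.tendsto
  have h1 : deriv (fun t : ℝ => Φ (v + t • w) ^ 2) =ᶠ[𝓝 0]
      fun t => 2 * (Φ (v + t • w) * fderiv ℝ Φ (v + t • w) w) := by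
    filter_upwards [hcont.eventually (eventually_differentiableAt_of_contDiffAt_two hΦ)] with t ht
    have := (ht.hasFDerivAt.comp_hasDerivAt t (hline t)).pow 2
    refine this.deriv.trans ?_
    simp only [Function.comp_apply]
    ring
  have hd : HasFDerivAt Φ (fderiv ℝ Φ v) (v + (0 : ℝ) • w) := by
    simpa using (hΦ.differentiableAt (by norm_num)).hasFDerivAt
  have hd2 : HasFDerivAt (fderiv ℝ Φ) (fderiv ℝ (fderiv ℝ Φ) v) (v + (0 : ℝ) • w) := by
    simpa using (differentiableAt_fderiv_of_contDiffAt_two hΦ).hasFDerivAt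
  have h2 : HasDerivAt (fun t : ℝ => fderiv ℝ Φ (v + t • w) w)
      (fderiv ℝ (fderiv ℝ Φ) v w w) 0 := by
    exact (ContinuousLinearMap.apply ℝ ℝ w).hasFDerivAt.comp_hasDerivAt (0 : ℝ)
      (hd2.comp_hasDerivAt (0 : ℝ) (hline 0))
  have h3 := ((hd.comp_hasDerivAt (0 : ℝ) (hline 0)).mul h2).const_mul 2
  rw [iteratedDeriv_succ, iteratedDeriv_one, h1.deriv_eq]
  refine h3.deriv.trans ?_
  simp only [Function.comp_apply, zero_smul, add_zero]
  ring

/-- A linear form has constant derivative. This is why `F` and `F + β` share the Hessian factor of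
their angle densities. -/
theorem hessian_add_clm (hΦ : ContDiffAt ℝ 2 Φ v) (l : E →L[ℝ] ℝ) :
    fderiv ℝ (fderiv ℝ fun w => Φ w + l w) v = fderiv ℝ (fderiv ℝ Φ) v := by
  have h : (fderiv ℝ fun w => Φ w + l w) =ᶠ[𝓝 v] fun w => fderiv ℝ Φ w + l := by
    filter_upwards [eventually_differentiableAt_of_contDiffAt_two hΦ] with w hw
    exact (hw.hasFDerivAt.add l.hasFDerivAt).fderiv
  rw [h.fderiv_eq, fderiv_add_const]

theorem fderiv_comp_neg {V : Type*} [NormedAddCommGroup V] [NormedSpace ℝ V] (f : E → V) (x : E) :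
    fderiv ℝ (fun z => f (-z)) x = -fderiv ℝ f (-x) := by
  have h := (ContinuousLinearEquiv.neg ℝ (M := E)).comp_right_fderiv (f := f) (x := x)
  ext w
  have := congrArg (fun L : E →L[ℝ] V => L w) h
  exact this.trans (by simp)

theorem hessian_neg_of_even (heven : ∀ w, Φ (-w) = Φ w) (v : E) :
    fderiv ℝ (fderiv ℝ Φ) (-v) = fderiv ℝ (fderiv ℝ Φ) v := by
  have h1 : ∀ w, fderiv ℝ Φ (-w) = -fderiv ℝ Φ w := by
    intro w
    have h := fderiv_comp_neg Φ w
    rw [funext heven] at h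
    rw [h, neg_neg]
  have h := fderiv_comp_neg (fderiv ℝ Φ) v
  rw [funext h1, fderiv_fun_neg] at h
  exact (neg_inj.mp h).symm

/-- Strong convexity makes the Hessian of a homogeneous function positive definite transversally
to the radial direction. -/
theorem hessian_pos_of_stronglyConvex (hom : ∀ w, ∀ c : ℝ, 0 < c → Φ (c • w) = c * Φ w)
    (hΦ : ContDiffAt ℝ 2 Φ v) (hpos : 0 < Φ v)
    (hconv : ∀ w, w ≠ 0 → 0 < iteratedDeriv 2 (fun t : ℝ => Φ (v + t • w) ^ 2) 0) (w : E) :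
    0 ≤ fderiv ℝ (fderiv ℝ Φ) v w w ∧
      (fderiv ℝ (fderiv ℝ Φ) v w w = 0 → ∃ c : ℝ, w = c • v) := by
  -- Subtracting `c • v` moves `w` into the kernel of the first derivative without changing the
  -- Hessian, so convexity of the square controls the Hessian alone.
  set c := fderiv ℝ Φ v w / Φ v with hc
  have hE := fderiv_apply_self_of_homogeneous hom (hΦ.differentiableAt (by norm_num))
  have hH := hessian_apply_self_of_homogeneous hom hΦ
  have hH' : ∀ z, fderiv ℝ (fderiv ℝ Φ) v v z = 0 := fun z => by rw [hessian_symm hΦ, hH]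
  have hw' : fderiv ℝ Φ v (w - c • v) = 0 := by
    rw [map_sub, map_smul, hE, smul_eq_mul, hc, div_mul_cancel₀ _ hpos.ne', sub_self]
  have hHw : fderiv ℝ (fderiv ℝ Φ) v (w - c • v) (w - c • v) = fderiv ℝ (fderiv ℝ Φ) v w w := by
    simp [hH, hH']
  by_cases h0 : w - c • v = 0
  · refine ⟨?_, fun _ => ⟨c, sub_eq_zero.mp h0⟩⟩
    rw [← hHw, h0]; simp
  · have := hconv _ h0
    rw [iteratedDeriv_two_sq_line hΦ, hw', hHw] at this
    have h1 : 0 < Φ v * fderiv ℝ (fderiv ℝ Φ) v w w := by nlinarith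
    have h2 : 0 < fderiv ℝ (fderiv ℝ Φ) v w w := (mul_pos_iff_of_pos_left hpos).mp h1
    exact ⟨h2.le, fun h => absurd h h2.ne'⟩

end FibreCalculus

/-! ### Existence and projection of the geodesic vector: linear algebra -/

section ReebVector

variable {E : Type*} [NormedAddCommGroup E] [NormedSpace ℝ E]

/-- Linear algebra behind the geodesic vector: `D` and `B` are the first and second derivatives at
`(y, v)` of a Finsler metric with value `g`. -/
structure IsFinslerJet (D : E × E →L[ℝ] ℝ) (B : E × E →L[ℝ] E × E →L[ℝ] ℝ) (g : ℝ) (v : E) :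
    Prop where
  pos : 0 < g
  euler : D (0, v) = g
  euler' : ∀ Z, B Z (0, v) = D (Z.1, 0)
  convex : ∀ w, w ≠ 0 → 0 < D (0, w) ^ 2 + g * B (0, w) (0, w)

/-- The vector `g⁻¹ • v` satisfies the same conditions, and on the difference both terms of the
positive form in `convex` vanish. -/
theorem IsFinslerJet.fst_eq {D : E × E →L[ℝ] ℝ} {B : E × E →L[ℝ] E × E →L[ℝ] ℝ} {g : ℝ} {v : E}
    (h : IsFinslerJet D B g v) {z : E} (h1 : D (0, z) = 1) (h2 : ∀ w, B (0, w) (0, z) = 0) :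
    z = g⁻¹ • v := by
  by_contra hne
  have hsplit : ((0 : E), z - g⁻¹ • v) = (0, z) - g⁻¹ • (0, v) := by simp
  have := h.convex (z - g⁻¹ • v) (sub_ne_zero.mpr hne)
  have e1 : D (0, z - g⁻¹ • v) = 0 := by
    rw [hsplit, map_sub, map_smul, h1, h.euler, smul_eq_mul, inv_mul_cancel₀ h.pos.ne', sub_self]
  have e2 : B (0, z - g⁻¹ • v) (0, z - g⁻¹ • v) = 0 := by
    conv_lhs => rw [hsplit]
    rw [map_sub (B _), map_smul (B _), ← hsplit, h2, h.euler']
    have : ((0 : E), (0 : E)) = 0 := rfl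
    simp [this]
  rw [e1, e2] at this
  simp at this

/-- The base component must be `g⁻¹ • v`. The fibre component `z` has to solve `B (0, z) (0, w) = R
w` for all `w` together with `D (0, z) = -D (g⁻¹ • v, 0)`. The fibre part of `B` is degenerate along
`v`, so both equations are merged into one for the definite form `K = g B + D ⊗ D`. -/
theorem IsFinslerJet.exists_reeb [FiniteDimensional ℝ E] {D : E × E →L[ℝ] ℝ}
    {B : E × E →L[ℝ] E × E →L[ℝ] ℝ} {g : ℝ} {v : E} (h : IsFinslerJet D B g v) :
    ∃ Z : E × E, D (0, Z.1) = 1 ∧ (∀ W : E × E, B Z (0, W.1) - B W (0, Z.1) = 0) ∧ D Z = 0 := by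
  let i1 : E →ₗ[ℝ] E × E := LinearMap.inl ℝ E E
  let i2 : E →ₗ[ℝ] E × E := LinearMap.inr ℝ E E
  let D2 : E →ₗ[ℝ] ℝ := D.toLinearMap ∘ₗ i2
  let K : E →ₗ[ℝ] Module.Dual ℝ E := LinearMap.mk₂ ℝ
    (fun w w' => g * B (0, w) (0, w') + D (0, w) * D (0, w'))
    (fun a b c => by
      have : ((0 : E), a + b) = (0, a) + (0, b) := by simp
      simp only [this, map_add, add_apply]; ring)
    (fun r a c => by
      have : ((0 : E), r • a) = r • (0, a) := by simp
      simp only [this, map_smul, smul_apply, smul_eq_mul]; ring)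
    (fun a b c => by
      have : ((0 : E), b + c) = (0, b) + (0, c) := by simp
      simp only [this, map_add]; ring)
    (fun r a c => by
      have : ((0 : E), r • c) = r • (0, c) := by simp
      simp only [this, map_smul, smul_eq_mul]; ring)
  have hK : ∀ w w', K w w' = g * B (0, w) (0, w') + D (0, w) * D (0, w') := fun _ _ => rfl
  have hinj : Function.Injective K := by
    rw [injective_iff_map_eq_zero]
    intro w hw
    by_contra hne
    have h1 := h.convex w hne
    have h2 := hK w w
    rw [hw, LinearMap.zero_apply] at h2
    nlinarith
  have hsurj : Function.Surjective K :=
    (LinearMap.injective_iff_surjective_of_finrank_eq_finrank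
      (Subspace.dual_finrank_eq (K := ℝ) (V := E)).symm).mp hinj
  let R : Module.Dual ℝ E := g⁻¹ • (D.toLinearMap ∘ₗ i1) -
    (B (g⁻¹ • v, 0)).toLinearMap ∘ₗ i2
  have hR : ∀ w, R w = g⁻¹ * D (w, 0) - B (g⁻¹ • v, 0) (0, w) := fun _ => rfl
  have hz : ((g⁻¹ • v : E), (0 : E)) = g⁻¹ • (v, 0) := by simp
  have hz' : ((0 : E), (g⁻¹ • v : E)) = g⁻¹ • (0, v) := by simp
  -- Compatibility along the degenerate direction: evaluating the merged equation at `v` then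
  -- isolates the equation for `D (0, z)`.
  have hRv : R v = 0 := by
    rw [hR, h.euler', hz, map_smul, smul_eq_mul, sub_self]
  obtain ⟨z, hzK⟩ := hsurj (g • R - D (g⁻¹ • v, 0) • D2)
  have hKz : ∀ w, g * B (0, z) (0, w) + D (0, z) * D (0, w) =
      g * R w - D (g⁻¹ • v, 0) * D (0, w) := fun w => by
    rw [← hK, hzK]; rfl
  have hDz : D (0, z) = - D (g⁻¹ • v, 0) := by
    have := hKz v
    rw [h.euler, h.euler', hRv] at this
    have h00 : ((0 : E), (0 : E)) = 0 := rfl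
    simp only [h00, map_zero, mul_zero, zero_add, zero_sub] at this
    have h3 : (D (0, z) + D (g⁻¹ • v, 0)) * g = 0 := by linarith
    rcases mul_eq_zero.mp h3 with h4 | h4
    · linarith
    · exact absurd h4 h.pos.ne'
  have hBz : ∀ w, B (0, z) (0, w) = R w := fun w => by
    have := hKz w
    rw [hDz] at this
    have h3 : g * B (0, z) (0, w) = g * R w := by linarith
    exact mul_left_cancel₀ h.pos.ne' h3
  have hsplit : ((g⁻¹ • v : E), z) = (g⁻¹ • v, 0) + (0, z) := by simp
  refine ⟨(g⁻¹ • v, z), ?_, fun W => ?_, ?_⟩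
  · simp only [hz']
    rw [map_smul, h.euler, smul_eq_mul, inv_mul_cancel₀ h.pos.ne']
  · simp only [hz']
    rw [hsplit, map_add, add_apply, hBz, hR, map_smul, h.euler', smul_eq_mul]
    ring
  · rw [hsplit, map_add, hDz]
    ring

end ReebVector

/-! ### Charts of the tangent bundle induced by charts of the base -/

section TangentChart

open Filter Topology

variable {m : ℕ} {M : Type*} [TopologicalSpace M] [ChartedSpace (Model m) M]

/-- The coordinates of `p` in the chart of `TM` induced by the preferred chart at its base point. -/
def chartPoint (p : TangentBundle (𝓡 (m + 1)) M) : Model m × Model m :=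
  (extChartAt (𝓡 (m + 1)) p.1 p.1, p.2)

theorem eventually_fst_mem_target (p : TangentBundle (𝓡 (m + 1)) M) :
    ∀ᶠ q : Model m × Model m in 𝓝 (chartPoint p), q.1 ∈ (extChartAt (𝓡 (m + 1)) p.1).target := by
  have h : (extChartAt (𝓡 (m + 1)) p.1).target ∈ 𝓝 (chartPoint p).1 :=
    extChartAt_target_mem_nhds (I := 𝓡 (m + 1)) p.1
  exact continuousAt_fst.eventually h

variable [IsManifold (𝓡 (m + 1)) ∞ M]

/-- The inverse of the chart of `TM` induced by the preferred chart of `M` at `x`. -/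
def tangentChartSymm (x : M) (q : Model m × Model m) : TangentBundle (𝓡 (m + 1)) M :=
  ⟨(extChartAt (𝓡 (m + 1)) x).symm q.1,
    (trivializationAt (Model m) (TangentSpace (𝓡 (m + 1))) x).symmL ℝ
      ((extChartAt (𝓡 (m + 1)) x).symm q.1) q.2⟩

theorem extChartAt_tangent_apply (p q : TangentBundle (𝓡 (m + 1)) M) :
    extChartAt (𝓡 (m + 1)).tangent p q = (extChartAt (𝓡 (m + 1)) p.1 q.1,
      (trivializationAt (Model m) (TangentSpace (𝓡 (m + 1))) p.1 q).2) := rfl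

theorem mem_extChartAt_tangent_target {p : TangentBundle (𝓡 (m + 1)) M} {q : Model m × Model m} :
    q ∈ (extChartAt (𝓡 (m + 1)).tangent p).target ↔ q.1 ∈ (extChartAt (𝓡 (m + 1)) p.1).target := by
  have h := FiberBundle.extChartAt_target (IB := 𝓡 (m + 1)) (F := Model m)
    (E := (TangentSpace (𝓡 (m + 1)) : M → Type _)) p
  refine (Set.ext_iff.mp h q).trans ⟨fun h => h.1.1, fun h => ⟨⟨h, ?_⟩, trivial⟩⟩
  have h := (extChartAt (𝓡 (m + 1)) p.1).map_target h
  rwa [extChartAt_source] at h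

theorem extChartAt_tangent_self (p : TangentBundle (𝓡 (m + 1)) M) :
    extChartAt (𝓡 (m + 1)).tangent p p = chartPoint p := by
  rw [extChartAt_tangent_apply, chartPoint]
  congr 1
  exact tangentCoordChange_self (mem_extChartAt_source _)

theorem extChartAt_tangent_symm (p : TangentBundle (𝓡 (m + 1)) M) {q : Model m × Model m}
    (hq : q.1 ∈ (extChartAt (𝓡 (m + 1)) p.1).target) :
    (extChartAt (𝓡 (m + 1)).tangent p).symm q = tangentChartSymm p.1 q := by
  have h := (extChartAt (𝓡 (m + 1)) p.1).map_target hq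
  rw [extChartAt_source] at h
  rw [tangentChartSymm, TangentBundle.symmL_trivializationAt_eq_core h]
  rfl

theorem tangentChartSymm_self (x : M) (w : Model m) :
    tangentChartSymm x (extChartAt (𝓡 (m + 1)) x x, w) = ⟨x, w⟩ := by
  have h := extChartAt_tangent_self (⟨x, w⟩ : TangentBundle (𝓡 (m + 1)) M)
  have h2 := extChartAt_tangent_symm (⟨x, w⟩ : TangentBundle (𝓡 (m + 1)) M)
    (q := (extChartAt (𝓡 (m + 1)) x x, w)) (mem_extChartAt_target x)
  rw [← h2]
  have h3 := (extChartAt (𝓡 (m + 1)).tangent (⟨x, w⟩ : TangentBundle (𝓡 (m + 1)) M)).left_inv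
    (mem_extChartAt_source _)
  rw [h] at h3
  exact h3

theorem comp_extChartAt_tangent_symm_eventuallyEq {N : Type*} (g : TangentBundle (𝓡 (m + 1)) M → N)
    (p : TangentBundle (𝓡 (m + 1)) M) :
    (fun q => g ((extChartAt (𝓡 (m + 1)).tangent p).symm q))
      =ᶠ[𝓝 (chartPoint p)] fun q => g (tangentChartSymm p.1 q) := by
  filter_upwards [eventually_fst_mem_target p] with q hq
  rw [extChartAt_tangent_symm p hq]

theorem mfderiv_eq_fderiv_chart {g : TangentBundle (𝓡 (m + 1)) M → ℝ}
    {p : TangentBundle (𝓡 (m + 1)) M}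
    (hg : MDifferentiableAt (𝓡 (m + 1)).tangent 𝓘(ℝ, ℝ) g p)
    (Z : TangentSpace (𝓡 (m + 1)).tangent p) :
    mfderiv (𝓡 (m + 1)).tangent 𝓘(ℝ, ℝ) g p Z =
      fderiv ℝ (fun q => g (tangentChartSymm p.1 q)) (chartPoint p) Z := by
  rw [hg.mfderiv, ModelWithCorners.Boundaryless.range_eq_univ, fderivWithin_univ,
    extChartAt_tangent_self p]
  exact congrArg (fun L : Model m × Model m →L[ℝ] ℝ => L Z)
    ((comp_extChartAt_tangent_symm_eventuallyEq g p).fderiv_eq (𝕜 := ℝ))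

theorem contDiffAt_chart {g : TangentBundle (𝓡 (m + 1)) M → ℝ} {n : ℕ∞ω}
    {p : TangentBundle (𝓡 (m + 1)) M}
    (hg : ContMDiffAt (𝓡 (m + 1)).tangent 𝓘(ℝ, ℝ) n g p) :
    ContDiffAt ℝ n (fun q => g (tangentChartSymm p.1 q)) (chartPoint p) := by
  have h := (contMDiffAt_iff.mp hg).2
  rw [ModelWithCorners.Boundaryless.range_eq_univ, contDiffWithinAt_univ,
    extChartAt_tangent_self p] at h
  exact h.congr_of_eventuallyEq (comp_extChartAt_tangent_symm_eventuallyEq g p).symm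

theorem mdifferentiableAt_proj (p : TangentBundle (𝓡 (m + 1)) M) :
    MDifferentiableAt (𝓡 (m + 1)).tangent (𝓡 (m + 1))
      (fun q : TangentBundle (𝓡 (m + 1)) M => q.1) p :=
  (contMDiff_proj (TangentSpace (𝓡 (m + 1)) : M → Type _) (n := ∞)).mdifferentiableAt (by simp)

theorem dproj_apply (p : TangentBundle (𝓡 (m + 1)) M) (Z : TangentSpace (𝓡 (m + 1)).tangent p) :
    dproj p Z = (show Model m × Model m from Z).1 := by
  rw [dproj, (mdifferentiableAt_proj p).mfderiv, ModelWithCorners.Boundaryless.range_eq_univ,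
    fderivWithin_univ, extChartAt_tangent_self p]
  have h : writtenInExtChartAt (𝓡 (m + 1)).tangent (𝓡 (m + 1)) p
      (fun q : TangentBundle (𝓡 (m + 1)) M => q.1)
      =ᶠ[𝓝 (chartPoint p)] (Prod.fst : Model m × Model m → Model m) := by
    filter_upwards [eventually_fst_mem_target p] with q hq
    exact (extChartAt (𝓡 (m + 1)) p.1).right_inv hq
  have h' := (h.fderiv_eq (𝕜 := ℝ)).trans fderiv_fst
  exact congrArg (fun L : Model m × Model m →L[ℝ] Model m => L Z) h'

/-- The exterior derivative differentiates the Hilbert form along nearby points of a fixed chart, so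
`dproj` of a constant coordinate field is needed off the centre of that chart too. -/
theorem dproj_mfderiv_chart_symm (p : TangentBundle (𝓡 (m + 1)) M) {q : Model m × Model m}
    (hq : q.1 ∈ (extChartAt (𝓡 (m + 1)) p.1).target) (U : Model m × Model m) :
    dproj ((extChartAt (𝓡 (m + 1)).tangent p).symm q)
      (mfderiv 𝓘(ℝ, Model m × Model m) (𝓡 (m + 1)).tangent
        (extChartAt (𝓡 (m + 1)).tangent p).symm q U) =
    (trivializationAt (Model m) (TangentSpace (𝓡 (m + 1))) p.1).symmL ℝ
      ((extChartAt (𝓡 (m + 1)) p.1).symm q.1) U.1 := by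
  have h := (extChartAt (𝓡 (m + 1)) p.1).map_target hq
  rw [extChartAt_source] at h
  have hd : MDifferentiableAt 𝓘(ℝ, Model m × Model m) (𝓡 (m + 1)).tangent
      (extChartAt (𝓡 (m + 1)).tangent p).symm q := by
    have := mdifferentiableWithinAt_extChartAt_symm (I := (𝓡 (m + 1)).tangent) (x := p)
      (mem_extChartAt_tangent_target.mpr hq)
    rwa [ModelWithCorners.Boundaryless.range_eq_univ, mdifferentiableWithinAt_univ] at this
  have hd' : MDifferentiableAt 𝓘(ℝ, Model m) (𝓡 (m + 1))
      (extChartAt (𝓡 (m + 1)) p.1).symm q.1 := by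
    have := mdifferentiableWithinAt_extChartAt_symm (I := 𝓡 (m + 1)) (x := p.1) hq
    rwa [ModelWithCorners.Boundaryless.range_eq_univ, mdifferentiableWithinAt_univ] at this
  have h1 := mfderiv_comp q (mdifferentiableAt_proj _) hd
  have h2 := mfderiv_comp (I := 𝓘(ℝ, Model m × Model m)) q (f := Prod.fst) hd'
    (differentiableAt_fst.mdifferentiableAt)
  have h3 := TangentBundle.symmL_trivializationAt (I := 𝓡 (m + 1)) (𝕜 := ℝ) h
  rw [(extChartAt (𝓡 (m + 1)) p.1).right_inv hq, ModelWithCorners.Boundaryless.range_eq_univ,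
    mfderivWithin_univ] at h3
  rw [h3]
  have h4 := congrArg (fun L => L U) (h1.symm.trans h2)
  refine h4.trans ?_
  simp only [mfderiv_eq_fderiv]
  rw [fderiv_fst]
  rfl

end TangentChart

/-! ### The Hilbert form and the geodesic field in coordinates -/

section Geodesic

open Filter Topology

variable {m : ℕ} {M : Type*} [TopologicalSpace M] [ChartedSpace (Model m) M]
  [IsManifold (𝓡 (m + 1)) ∞ M]

/-- The restriction of a function on `TM` to the fibre over `x`. -/
def fiberFun (F : TangentBundle (𝓡 (m + 1)) M → ℝ) (x : M) (w : Model m) : ℝ := F ⟨x, w⟩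

/-- The expression of a function on `TM` in the chart induced by the preferred chart at `x`. -/
def localRep (F : TangentBundle (𝓡 (m + 1)) M → ℝ) (x : M) (q : Model m × Model m) : ℝ :=
  F (tangentChartSymm x q)

theorem localRep_self (F : TangentBundle (𝓡 (m + 1)) M → ℝ) (x : M) (w : Model m) :
    localRep F x (extChartAt (𝓡 (m + 1)) x x, w) = fiberFun F x w := by
  rw [localRep, tangentChartSymm_self]
  rfl

theorem contDiffAt_fiberFun {F : TangentBundle (𝓡 (m + 1)) M → ℝ} {x : M} {v : Model m} {n : ℕ∞ω}
    (h : ContDiffAt ℝ n (localRep F x) (extChartAt (𝓡 (m + 1)) x x, v)) :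
    ContDiffAt ℝ n (fiberFun F x) v := by
  have h2 : ContDiffAt ℝ n (fun w : Model m => localRep F x (extChartAt (𝓡 (m + 1)) x x, w)) v :=
    ContDiffAt.comp v (f := fun w : Model m => (extChartAt (𝓡 (m + 1)) x x, w)) h
      (contDiffAt_const.prodMk contDiffAt_id)
  simpa only [localRep_self] using h2

theorem fderiv_fiberFun {F : TangentBundle (𝓡 (m + 1)) M → ℝ} {x : M} {v : Model m}
    (h : DifferentiableAt ℝ (localRep F x) (extChartAt (𝓡 (m + 1)) x x, v)) :
    fderiv ℝ (fiberFun F x) v =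
      (fderiv ℝ (localRep F x) (extChartAt (𝓡 (m + 1)) x x, v)).comp
        (ContinuousLinearMap.inr ℝ (Model m) (Model m)) := by
  have h2 : HasFDerivAt (fun w : Model m => localRep F x (extChartAt (𝓡 (m + 1)) x x, w))
      ((fderiv ℝ (localRep F x) (extChartAt (𝓡 (m + 1)) x x, v)).comp
        (ContinuousLinearMap.inr ℝ (Model m) (Model m))) v :=
    h.hasFDerivAt.comp v (hasFDerivAt_prodMk_right _ v)
  simp only [localRep_self] at h2
  exact h2.fderiv

theorem hessian_fiberFun {F : TangentBundle (𝓡 (m + 1)) M → ℝ} {x : M} {v : Model m}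
    (h : ContDiffAt ℝ 2 (localRep F x) (extChartAt (𝓡 (m + 1)) x x, v)) (a b : Model m) :
    fderiv ℝ (fderiv ℝ (fiberFun F x)) v a b =
      fderiv ℝ (fderiv ℝ (localRep F x)) (extChartAt (𝓡 (m + 1)) x x, v) (0, a) (0, b) := by
  have hc : Tendsto (fun w : Model m => (extChartAt (𝓡 (m + 1)) x x, w)) (𝓝 v)
      (𝓝 (extChartAt (𝓡 (m + 1)) x x, v)) :=
    (hasFDerivAt_prodMk_right (𝕜 := ℝ) (extChartAt (𝓡 (m + 1)) x x) v).continuousAt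
  have h1 : fderiv ℝ (fiberFun F x) =ᶠ[𝓝 v] fun w =>
      (fderiv ℝ (localRep F x) (extChartAt (𝓡 (m + 1)) x x, w)).comp
        (ContinuousLinearMap.inr ℝ (Model m) (Model m)) := by
    filter_upwards [hc.eventually (eventually_differentiableAt_of_contDiffAt_two h)] with w hw
    exact fderiv_fiberFun hw
  have h2 := (differentiableAt_fderiv_of_contDiffAt_two h).hasFDerivAt.comp v
    (hasFDerivAt_prodMk_right (𝕜 := ℝ) (extChartAt (𝓡 (m + 1)) x x) v)
  have h3 := h2.clm_comp (hasFDerivAt_const (ContinuousLinearMap.inr ℝ (Model m) (Model m)) v)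
  rw [h1.fderiv_eq]
  have h4 := congrArg (fun L : Model m →L[ℝ] Model m →L[ℝ] ℝ => L a b) h3.fderiv
  refine h4.trans ?_
  simp

variable {F : TangentBundle (𝓡 (m + 1)) M → ℝ}

theorem IsFinslerMetric.isOpen_slit (hF : IsFinslerMetric F) :
    IsOpen {p : TangentBundle (𝓡 (m + 1)) M | p.2 ≠ 0} := by
  have : {p : TangentBundle (𝓡 (m + 1)) M | p.2 ≠ 0} = F ⁻¹' {0}ᶜ := by
    ext p
    simp [hF.eq_zero_iff]
  rw [this]
  exact isOpen_compl_singleton.preimage hF.continuous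

theorem IsFinslerMetric.contMDiffAt (hF : IsFinslerMetric F) {p : TangentBundle (𝓡 (m + 1)) M}
    (hp : p.2 ≠ 0) : ContMDiffAt (𝓡 (m + 1)).tangent 𝓘(ℝ, ℝ) 2 F p :=
  hF.contMDiffOn.contMDiffAt (hF.isOpen_slit.mem_nhds hp)

theorem IsFinslerMetric.pos (hF : IsFinslerMetric F) {p : TangentBundle (𝓡 (m + 1)) M}
    (hp : p.2 ≠ 0) : 0 < F p :=
  lt_of_le_of_ne (hF.nonneg p) (fun h => hp ((hF.eq_zero_iff p).mp h.symm))

theorem IsFinslerMetric.contDiffAt_localRep (hF : IsFinslerMetric F) (x : M) {v : Model m}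
    (hv : v ≠ 0) : ContDiffAt ℝ 2 (localRep F x) (extChartAt (𝓡 (m + 1)) x x, v) :=
  contDiffAt_chart (p := ⟨x, v⟩) (hF.contMDiffAt (p := ⟨x, v⟩) hv)

theorem IsFinslerMetric.localRep_homogeneous (hF : IsFinslerMetric F) (x : M) (y w : Model m)
    (c : ℝ) (hc : 0 < c) : localRep F x (y, c • w) = c * localRep F x (y, w) := by
  simp only [localRep, tangentChartSymm, map_smul]
  exact hF.homogeneous _ _ c hc

theorem IsFinslerMetric.contDiffAt_fiberFun (hF : IsFinslerMetric F) (x : M) {v : Model m}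
    (hv : v ≠ 0) : ContDiffAt ℝ 2 (fiberFun F x) v :=
  BF.contDiffAt_fiberFun (hF.contDiffAt_localRep x hv)

theorem IsFinslerMetric.fiberFun_homogeneous (hF : IsFinslerMetric F) (x : M) (w : Model m)
    (c : ℝ) (hc : 0 < c) : fiberFun F x (c • w) = c * fiberFun F x w :=
  hF.homogeneous x w c hc

theorem IsFinslerMetric.fiberFun_pos (hF : IsFinslerMetric F) (x : M) {v : Model m}
    (hv : v ≠ 0) : 0 < fiberFun F x v :=
  hF.pos (p := ⟨x, v⟩) hv

theorem IsFinslerMetric.isFinslerJet (hF : IsFinslerMetric F) (x : M) {v : Model m}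
    (hv : v ≠ 0) :
    IsFinslerJet (fderiv ℝ (localRep F x) (extChartAt (𝓡 (m + 1)) x x, v))
      (fderiv ℝ (fderiv ℝ (localRep F x)) (extChartAt (𝓡 (m + 1)) x x, v))
      (fiberFun F x v) v where
  pos := hF.fiberFun_pos x hv
  euler := by
    have h := fderiv_apply_snd_of_homogeneous (hF.localRep_homogeneous x)
      ((hF.contDiffAt_localRep x hv).differentiableAt (by norm_num))
    rwa [localRep_self] at h
  euler' := hessian_apply_snd_of_homogeneous (hF.localRep_homogeneous x)
    (hF.contDiffAt_localRep x hv)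
  convex := fun w hw => by
    have h := hF.stronglyConvex x v w hv hw
    have h2 := iteratedDeriv_two_sq_line (hF.contDiffAt_fiberFun x hv) w
    have h3 : 0 < iteratedDeriv 2 (fun t : ℝ => fiberFun F x (v + t • w) ^ 2) 0 := h
    rw [h2, hessian_fiberFun (hF.contDiffAt_localRep x hv),
      fderiv_fiberFun ((hF.contDiffAt_localRep x hv).differentiableAt (by norm_num))] at h3
    simp only [ContinuousLinearMap.comp_apply, ContinuousLinearMap.inr_apply] at h3
    linarith

/-- In coordinates the Hilbert form is the fibre derivative of the metric paired with `dx`, since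
the trivialization is linear on fibres. -/
theorem hilbertForm_chart (p : TangentBundle (𝓡 (m + 1)) M) {q : Model m × Model m}
    (hq : q.1 ∈ (extChartAt (𝓡 (m + 1)) p.1).target)
    (hd : DifferentiableAt ℝ (localRep F p.1) q) (U : Model m × Model m) :
    hilbertForm F ((extChartAt (𝓡 (m + 1)).tangent p).symm q)
      (mfderiv 𝓘(ℝ, Model m × Model m) (𝓡 (m + 1)).tangent
        (extChartAt (𝓡 (m + 1)).tangent p).symm q U) = fderiv ℝ (localRep F p.1) q (0, U.1) := by
  -- The two descriptions of the point agree only propositionally, so tangent vectors over them are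
  -- compared by `HEq`.
  have h1 : ∀ (ε : ℝ) (r : TangentBundle (𝓡 (m + 1)) M), r = tangentChartSymm p.1 q →
      ∀ W : TangentSpace (𝓡 (m + 1)) r.1,
      HEq W ((trivializationAt (Model m) (TangentSpace (𝓡 (m + 1))) p.1).symmL ℝ
        ((extChartAt (𝓡 (m + 1)) p.1).symm q.1) U.1) →
      F ⟨r.1, r.2 + ε • W⟩ = localRep F p.1 (q.1, q.2 + ε • U.1) := by
    rintro ε r rfl W hW
    rw [eq_of_heq hW]
    simp only [localRep, tangentChartSymm, map_add, map_smul]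
    rfl
  have h2 := funext fun ε => h1 ε _ (extChartAt_tangent_symm p hq) _
    (heq_of_eq (dproj_mfderiv_chart_symm p hq U))
  have hline : HasDerivAt (fun ε : ℝ => (q.1, q.2 + ε • U.1)) (0, U.1) 0 := by
    simpa using (hasDerivAt_const (0 : ℝ) q.1).prodMk
      (((hasDerivAt_id (0 : ℝ)).smul_const U.1).const_add q.2)
  have hd' : HasFDerivAt (localRep F p.1) (fderiv ℝ (localRep F p.1) q)
      (q.1, q.2 + (0 : ℝ) • U.1) := by simpa using hd.hasFDerivAt
  rw [hilbertForm, h2]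
  exact (hd'.comp_hasDerivAt (0 : ℝ) hline).deriv

theorem hilbertForm_apply {x : M} {v : Model m} (hd : DifferentiableAt ℝ (fiberFun F x) v)
    (Z : TangentSpace (𝓡 (m + 1)).tangent (⟨x, v⟩ : TangentBundle (𝓡 (m + 1)) M)) :
    hilbertForm F ⟨x, v⟩ Z = fderiv ℝ (fiberFun F x) v (show Model m × Model m from Z).1 := by
  rw [hilbertForm, dproj_apply]
  set w : Model m := (show Model m × Model m from Z).1
  have hline : HasDerivAt (fun ε : ℝ => v + ε • w) w 0 := by
    simpa using ((hasDerivAt_id (0 : ℝ)).smul_const w).const_add v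
  have hd' : HasFDerivAt (fiberFun F x) (fderiv ℝ (fiberFun F x) v) (v + (0 : ℝ) • w) := by
    simpa using hd.hasFDerivAt
  exact (hd'.comp_hasDerivAt (0 : ℝ) hline).deriv

theorem dHilbertForm_apply {x : M} {v : Model m}
    (hd : ContDiffAt ℝ 2 (localRep F x) (extChartAt (𝓡 (m + 1)) x x, v))
    (Z W : TangentSpace (𝓡 (m + 1)).tangent (⟨x, v⟩ : TangentBundle (𝓡 (m + 1)) M)) :
    dHilbertForm F ⟨x, v⟩ Z W =
      fderiv ℝ (fderiv ℝ (localRep F x)) (extChartAt (𝓡 (m + 1)) x x, v) Z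
        (0, (show Model m × Model m from W).1) -
      fderiv ℝ (fderiv ℝ (localRep F x)) (extChartAt (𝓡 (m + 1)) x x, v) W
        (0, (show Model m × Model m from Z).1) := by
  have key : ∀ U Y : Model m × Model m, fderiv ℝ (fun q => hilbertForm F
      ((extChartAt (𝓡 (m + 1)).tangent (⟨x, v⟩ : TangentBundle (𝓡 (m + 1)) M)).symm q)
      (mfderiv 𝓘(ℝ, Model m × Model m) (𝓡 (m + 1)).tangent
        (extChartAt (𝓡 (m + 1)).tangent (⟨x, v⟩ : TangentBundle (𝓡 (m + 1)) M)).symm q U))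
        (extChartAt (𝓡 (m + 1)) x x, v) Y =
      fderiv ℝ (fderiv ℝ (localRep F x)) (extChartAt (𝓡 (m + 1)) x x, v) Y (0, U.1) := by
    intro U Y
    have h : (fun q => hilbertForm F
      ((extChartAt (𝓡 (m + 1)).tangent (⟨x, v⟩ : TangentBundle (𝓡 (m + 1)) M)).symm q)
      (mfderiv 𝓘(ℝ, Model m × Model m) (𝓡 (m + 1)).tangent
        (extChartAt (𝓡 (m + 1)).tangent (⟨x, v⟩ : TangentBundle (𝓡 (m + 1)) M)).symm q U))
        =ᶠ[𝓝 (extChartAt (𝓡 (m + 1)) x x, v)]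
        fun q => fderiv ℝ (localRep F x) q (0, U.1) := by
      filter_upwards [eventually_fst_mem_target (⟨x, v⟩ : TangentBundle (𝓡 (m + 1)) M),
        eventually_differentiableAt_of_contDiffAt_two hd] with q hq hdq
      exact hilbertForm_chart (F := F) ⟨x, v⟩ hq hdq U
    rw [h.fderiv_eq]
    have h2 := (ContinuousLinearMap.apply ℝ ℝ ((0 : Model m), U.1)).hasFDerivAt.comp _
      (differentiableAt_fderiv_of_contDiffAt_two hd).hasFDerivAt
    exact congrArg (fun L : Model m × Model m →L[ℝ] ℝ => L Y) h2.fderiv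
  have hp := extChartAt_tangent_self (⟨x, v⟩ : TangentBundle (𝓡 (m + 1)) M)
  rw [dHilbertForm, extDerivOneForm]
  simp only [hp]
  exact congrArg₂ (· - ·) (key W Z) (key Z W)

theorem IsFinslerMetric.isGeodesicVector_iff (hF : IsFinslerMetric F) (x : M) {v : Model m}
    (hv : v ≠ 0)
    (Z : TangentSpace (𝓡 (m + 1)).tangent (⟨x, v⟩ : TangentBundle (𝓡 (m + 1)) M)) :
    IsGeodesicVector F ⟨x, v⟩ Z ↔
      fderiv ℝ (localRep F x) (extChartAt (𝓡 (m + 1)) x x, v)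
        (0, (show Model m × Model m from Z).1) = 1 ∧
      (∀ W : Model m × Model m,
        fderiv ℝ (fderiv ℝ (localRep F x)) (extChartAt (𝓡 (m + 1)) x x, v) Z (0, W.1) -
        fderiv ℝ (fderiv ℝ (localRep F x)) (extChartAt (𝓡 (m + 1)) x x, v) W
          (0, (show Model m × Model m from Z).1) = 0) ∧
      fderiv ℝ (localRep F x) (extChartAt (𝓡 (m + 1)) x x, v) Z = 0 := by
  have hd := hF.contDiffAt_localRep x hv
  have h1 := hilbertForm_apply ((hF.contDiffAt_fiberFun x hv).differentiableAt (by norm_num)) Z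
  rw [fderiv_fiberFun (hd.differentiableAt (by norm_num))] at h1
  have h3 := mfderiv_eq_fderiv_chart (p := ⟨x, v⟩)
    ((hF.contMDiffAt (p := ⟨x, v⟩) hv).mdifferentiableAt (by norm_num)) Z
  rw [IsGeodesicVector, h1, h3]
  simp only [dHilbertForm_apply hd]
  rfl

/-- The geodesic vector field exists and lifts `v / F(v)`. -/
theorem IsFinslerMetric.isGeodesicVector_geodesicField (hF : IsFinslerMetric F) (x : M)
    {v : Model m} (hv : v ≠ 0) :
    IsGeodesicVector F ⟨x, v⟩ (geodesicField F ⟨x, v⟩) := by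
  obtain ⟨Z, hZ⟩ := (hF.isFinslerJet x hv).exists_reeb
  exact Classical.epsilon_spec (p := IsGeodesicVector F ⟨x, v⟩)
    ⟨Z, (hF.isGeodesicVector_iff x hv Z).mpr hZ⟩

theorem IsFinslerMetric.dproj_geodesicField (hF : IsFinslerMetric F)
    {p : TangentBundle (𝓡 (m + 1)) M} (hp : p.2 ≠ 0) :
    dproj p (geodesicField F p) = (F p)⁻¹ • p.2 := by
  obtain ⟨x, v⟩ := p
  have h := (hF.isGeodesicVector_iff x hp _).mp (hF.isGeodesicVector_geodesicField x hp)
  rw [dproj_apply]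
  refine (hF.isFinslerJet x hp).fst_eq h.1 fun w => ?_
  have h2 := h.2.1 (0, w)
  have h00 : ((0 : Model m), (0 : Model m)) = 0 := rfl
  simpa [h00] using h2

end Geodesic

/-! ### Adding a one-form to a Finsler metric -/

section Randers

variable {m : ℕ} {M : Type*} [TopologicalSpace M] [ChartedSpace (Model m) M]

/-- The value of a one-form at `x`, as a linear form on the model space. -/
def modelForm (β : ∀ x : M, TangentSpace (𝓡 (m + 1)) x →L[ℝ] ℝ) (x : M) : Model m →L[ℝ] ℝ := β x

theorem fiberFun_addOneForm (F : TangentBundle (𝓡 (m + 1)) M → ℝ)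
    (β : ∀ x : M, TangentSpace (𝓡 (m + 1)) x →L[ℝ] ℝ) (x : M) :
    fiberFun (addOneForm F β) x = fun w => fiberFun F x w + modelForm β x w :=
  rfl

variable [IsManifold (𝓡 (m + 1)) ∞ M] {F : TangentBundle (𝓡 (m + 1)) M → ℝ}

theorem IsFinslerMetric.continuous_fiberFun (hF : IsFinslerMetric F) (x : M) :
    Continuous (fiberFun F x) :=
  hF.continuous.comp
    (FiberBundle.continuous_totalSpaceMk (Model m) (TangentSpace (𝓡 (m + 1)) : M → Type _) x)

theorem IsFinslerMetric.exists_norm_le (hF : IsFinslerMetric F) (x : M) :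
    ∃ c : ℝ, 0 < c ∧ ∀ v : Model m, c * ‖v‖ ≤ fiberFun F x v := by
  obtain ⟨u, hu, hmin⟩ := (isCompact_sphere (0 : Model m) 1).exists_isMinOn
    (NormedSpace.sphere_nonempty.mpr zero_le_one) (hF.continuous_fiberFun x).continuousOn
  have hu0 : u ≠ 0 := ne_zero_of_mem_unit_sphere ⟨u, hu⟩
  refine ⟨fiberFun F x u, hF.fiberFun_pos x hu0, fun v => ?_⟩
  by_cases hv : v = 0
  · subst hv
    rw [norm_zero, mul_zero]
    exact hF.nonneg ⟨x, (0 : Model m)⟩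
  · have hn : 0 < ‖v‖ := norm_pos_iff.mpr hv
    have h1 : fiberFun F x u ≤ fiberFun F x (‖v‖⁻¹ • v) := hmin (by simp [norm_smul, hn.ne'])
    rw [hF.fiberFun_homogeneous x v _ (inv_pos.mpr hn), inv_mul_eq_div, le_div_iff₀ hn] at h1
    exact h1

theorem IsFinslerMetric.lt_of_dualMetric_lt_one (hF : IsFinslerMetric F) {x : M}
    {l : Model m →L[ℝ] ℝ} (hl : dualMetric F x l < 1) {v : Model m} (hv : v ≠ 0) :
    l v < fiberFun F x v := by
  obtain ⟨c, hc, hcle⟩ := hF.exists_norm_le x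
  -- Boundedness of the indicatrix makes the `sSup` in `dualMetric` a genuine supremum.
  have hb : BddAbove {r | ∃ v : Model m, fiberFun F x v = 1 ∧ l v = r} := by
    refine ⟨‖l‖ * c⁻¹, ?_⟩
    rintro r ⟨w, hw, rfl⟩
    have h1 := hcle w
    rw [hw, mul_comm, ← le_div_iff₀ hc, one_div] at h1
    exact (le_abs_self _).trans ((l.le_opNorm w).trans
      (mul_le_mul_of_nonneg_left h1 (norm_nonneg _)))
  have hpos := hF.fiberFun_pos x hv
  have h0 : fiberFun F x ((fiberFun F x v)⁻¹ • v) = 1 := by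
    rw [hF.fiberFun_homogeneous x v _ (inv_pos.mpr hpos), inv_mul_cancel₀ hpos.ne']
  have h1 : l ((fiberFun F x v)⁻¹ • v) ≤ dualMetric F x l :=
    le_csSup hb ⟨(fiberFun F x v)⁻¹ • v, h0, rfl⟩
  have h2 := h1.trans_lt hl
  rw [map_smul, smul_eq_mul, inv_mul_eq_div, div_lt_one hpos] at h2
  exact h2

theorem IsFinslerMetric.hessian_fiberFun_addOneForm (hF : IsFinslerMetric F)
    (β : ∀ x : M, TangentSpace (𝓡 (m + 1)) x →L[ℝ] ℝ) (x : M) {v : Model m} (hv : v ≠ 0) :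
    fderiv ℝ (fderiv ℝ (fiberFun (addOneForm F β) x)) v =
      fderiv ℝ (fderiv ℝ (fiberFun F x)) v := by
  rw [fiberFun_addOneForm]
  exact hessian_add_clm (hF.contDiffAt_fiberFun x hv) _

/-- The Hessian is that of `F`, positive off the radial direction. For radial `w = c • v` the first
derivative contributes `(c (F + β)(v))² > 0` instead. -/
theorem IsFinslerMetric.stronglyConvex_fiberFun_addOneForm (hF : IsFinslerMetric F)
    {β : ∀ x : M, TangentSpace (𝓡 (m + 1)) x →L[ℝ] ℝ} {x : M} {v w : Model m} (hv : v ≠ 0)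
    (hw : w ≠ 0) (hp : 0 < fiberFun (BF.addOneForm F β) x v) :
    0 < iteratedDeriv 2 (fun t : ℝ => fiberFun (BF.addOneForm F β) x (v + t • w) ^ 2) 0 := by
  have hΦ := hF.contDiffAt_fiberFun x hv
  have hΦ' : ContDiffAt ℝ 2 (fiberFun (BF.addOneForm F β) x) v := by
    rw [fiberFun_addOneForm]
    exact hΦ.add (modelForm β x).contDiff.contDiffAt
  have hhom : ∀ w : Model m, ∀ c : ℝ, 0 < c →
      fiberFun (BF.addOneForm F β) x (c • w) = c * fiberFun (BF.addOneForm F β) x w := by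
    intro w c hc
    simp only [fiberFun_addOneForm, hF.fiberFun_homogeneous x w c hc, map_smul, smul_eq_mul]
    ring
  rw [iteratedDeriv_two_sq_line hΦ' w, hF.hessian_fiberFun_addOneForm β x hv]
  obtain ⟨h0, h1⟩ := hessian_pos_of_stronglyConvex (hF.fiberFun_homogeneous x) hΦ
    (hF.fiberFun_pos x hv) (fun w hw => hF.stronglyConvex x v w hv hw) w
  rcases h0.eq_or_lt with h | h
  · obtain ⟨c, hc⟩ := h1 h.symm
    have hc0 : c ≠ 0 := by
      rintro rfl
      exact hw (by rw [hc, zero_smul])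
    rw [← h, hc, map_smul,
      fderiv_apply_self_of_homogeneous hhom (hΦ'.differentiableAt (by norm_num)), mul_zero,
      add_zero]
    have := smul_ne_zero hc0 hp.ne'
    positivity
  · have := mul_pos hp h
    positivity

/-- A Finsler metric plus a one-form of dual norm less than one is a Finsler metric. -/
theorem IsFinslerMetric.addOneForm (hF : IsFinslerMetric F)
    {β : ∀ x : M, TangentSpace (𝓡 (m + 1)) x →L[ℝ] ℝ} (hβ : IsC2OneForm β)
    (hβ1 : ∀ (x : M) (v : Model m), v ≠ 0 →
      0 < fiberFun F x v + modelForm β x v) :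
    IsFinslerMetric (addOneForm F β) := by
  have hpos : ∀ p : TangentBundle (𝓡 (m + 1)) M, p.2 ≠ 0 → 0 < BF.addOneForm F β p :=
    fun p hp => hβ1 p.1 p.2 hp
  have hzero : ∀ p : TangentBundle (𝓡 (m + 1)) M, p.2 = 0 → BF.addOneForm F β p = 0 := by
    intro p hp
    rw [BF.addOneForm, (hF.eq_zero_iff p).mpr hp, hp, map_zero, add_zero]
  refine ⟨hF.continuous.add hβ.continuous, hF.contMDiffOn.add hβ.contMDiffOn, ?_, ?_, ?_, ?_⟩
  · intro x v c hc
    simp only [BF.addOneForm, hF.homogeneous x v c hc, map_smul, smul_eq_mul]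
    ring
  · intro p
    by_cases hp : p.2 = 0
    · exact (hzero p hp).ge
    · exact (hpos p hp).le
  · intro p
    refine ⟨fun h => ?_, hzero p⟩
    by_contra hp
    exact (hpos p hp).ne' h
  · intro x v w hv hw
    exact hF.stronglyConvex_fiberFun_addOneForm hv hw (hβ1 x v hv)

end Randers

/-! ### Derivatives along the geodesic field -/

section LieDerivative

open Filter Topology

variable {m : ℕ} {M : Type*} [TopologicalSpace M] [ChartedSpace (Model m) M]
  [IsManifold (𝓡 (m + 1)) ∞ M] {F : TangentBundle (𝓡 (m + 1)) M → ℝ}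

theorem IsFinslerMetric.lieX_pull (hF : IsFinslerMetric F) {p : TangentBundle (𝓡 (m + 1)) M}
    (hp : p.2 ≠ 0) {f : M → ℝ} (hf : MDifferentiableAt (𝓡 (m + 1)) 𝓘(ℝ, ℝ) f p.1) :
    lieX F (pull f) p = (F p)⁻¹ * (show ℝ from mfderiv (𝓡 (m + 1)) 𝓘(ℝ, ℝ) f p.1 p.2) := by
  have h := mfderiv_comp p (g := f) (f := fun q : TangentBundle (𝓡 (m + 1)) M => q.1) hf
    (mdifferentiableAt_proj p)
  have h2 := congrArg (fun L => L (geodesicField F p)) h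
  refine h2.trans ?_
  have h3 := hF.dproj_geodesicField hp
  rw [dproj] at h3
  simp only [ContinuousLinearMap.comp_apply]
  rw [h3, map_smul]
  rfl

theorem mfderiv_coordFun_mul (x : M) (l : Model m →L[ℝ] ℝ) {q : TangentBundle (𝓡 (m + 1)) M}
    (p : TangentBundle (𝓡 (m + 1)) M) (hp : p.1 = x)
    (hq : q.1 ∈ (extChartAt (𝓡 (m + 1)) x).source) :
    MDifferentiableAt (𝓡 (m + 1)) 𝓘(ℝ, ℝ) (fun y => coordFun x l y * coordFun x l y) q.1 ∧
    mfderiv (𝓡 (m + 1)) 𝓘(ℝ, ℝ) (fun y => coordFun x l y * coordFun x l y) q.1 q.2 =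
      2 * l ((extChartAt (𝓡 (m + 1)).tangent p q).1 - extChartAt (𝓡 (m + 1)) x x) *
        l (extChartAt (𝓡 (m + 1)).tangent p q).2 := by
  subst hp
  rw [extChartAt_source] at hq
  set y₀ : Model m := extChartAt (𝓡 (m + 1)) p.1 p.1
  set h : Model m → ℝ := fun z => l (z - y₀) * l (z - y₀) with hh
  have hd : ∀ z, HasFDerivAt h (l (z - y₀) • l + l (z - y₀) • l) z := fun z => by
    have h1 : HasFDerivAt (fun z => l (z - y₀)) l z :=
      l.hasFDerivAt.comp z ((hasFDerivAt_id z).sub_const y₀)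
    exact h1.mul h1
  have h1 : MDifferentiableAt (𝓡 (m + 1)) 𝓘(ℝ, Model m) (extChartAt (𝓡 (m + 1)) p.1) q.1 :=
    mdifferentiableAt_extChartAt hq
  have h2 : MDifferentiableAt 𝓘(ℝ, Model m) 𝓘(ℝ, ℝ) h (extChartAt (𝓡 (m + 1)) p.1 q.1) :=
    (hd _).differentiableAt.mdifferentiableAt
  refine ⟨h2.comp q.1 h1, ?_⟩
  have h3 := congrArg (fun L => L q.2) (mfderiv_comp q.1 h2 h1)
  refine h3.trans ?_
  rw [← TangentBundle.continuousLinearMapAt_trivializationAt hq,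
    TangentBundle.continuousLinearMapAt_trivializationAt_eq_core hq]
  simp only [mfderiv_eq_fderiv, (hd _).fderiv]
  rw [two_mul, add_mul]
  rfl

/-- The second derivative along the geodesic field of the square of a coordinate function. -/
theorem IsFinslerMetric.lieX_lieX_pull_coordFun (hF : IsFinslerMetric F) (x : M)
    (l : Model m →L[ℝ] ℝ) {v : Model m} (hv : v ≠ 0) :
    lieX F (lieX F (pull fun y => coordFun x l y * coordFun x l y)) ⟨x, v⟩ =
      2 * (l v / fiberFun F x v) ^ 2 := by
  set p : TangentBundle (𝓡 (m + 1)) M := ⟨x, v⟩ with hp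
  set y₀ : Model m := extChartAt (𝓡 (m + 1)) x x with hy₀
  set G : Model m × Model m → ℝ :=
    fun q => l (q.1 - y₀) * (2 * l q.2 * (localRep F x q)⁻¹) with hG
  have hself : extChartAt (𝓡 (m + 1)).tangent p p = (y₀, v) := extChartAt_tangent_self p
  have hev : lieX F (pull fun y => coordFun x l y * coordFun x l y) =ᶠ[𝓝 p]
      G ∘ extChartAt (𝓡 (m + 1)).tangent p := by
    filter_upwards [hF.isOpen_slit.mem_nhds (show p ∈ {p | p.2 ≠ 0} from hv),
      extChartAt_source_mem_nhds (I := (𝓡 (m + 1)).tangent) p] with q hq hqs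
    have hqs' : q.1 ∈ (extChartAt (𝓡 (m + 1)) x).source := by
      rw [extChartAt_source] at hqs ⊢
      exact (TangentBundle.mem_chart_source_iff (I := 𝓡 (m + 1)) q p).mp hqs
    obtain ⟨h1, h2⟩ := mfderiv_coordFun_mul x l p rfl hqs'
    have h3 : localRep F x (extChartAt (𝓡 (m + 1)).tangent p q) = F q := by
      have hm := mem_extChartAt_tangent_target.mp
        ((extChartAt (𝓡 (m + 1)).tangent p).map_source hqs)
      rw [localRep, ← extChartAt_tangent_symm p hm,
        (extChartAt (𝓡 (m + 1)).tangent p).left_inv hqs]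
    rw [hF.lieX_pull hq h1, h2, Function.comp_apply, hG]
    simp only [h3]
    ring
  have hloc : DifferentiableAt ℝ (localRep F x) (y₀, v) :=
    (hF.contDiffAt_localRep x hv).differentiableAt (by norm_num)
  have hlv : localRep F x (y₀, v) = fiberFun F x v := localRep_self F x v
  have hpos := hF.fiberFun_pos x hv
  -- The factor `l (q.1 - y₀)` vanishes at the centre, so the derivative of the other factor drops
  -- out, and the fibre component of the geodesic vector plays no role.
  have hGd : HasFDerivAt G ((2 * l v * (fiberFun F x v)⁻¹) •
      l.comp (ContinuousLinearMap.fst ℝ (Model m) (Model m))) (y₀, v) := by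
    have h1 : HasFDerivAt (fun q : Model m × Model m => l (q.1 - y₀))
        (l.comp (ContinuousLinearMap.fst ℝ (Model m) (Model m))) (y₀, v) :=
      l.hasFDerivAt.comp (y₀, v)
        ((ContinuousLinearMap.fst ℝ (Model m) (Model m)).hasFDerivAt.sub_const y₀)
    have h2 : DifferentiableAt ℝ
        (fun q : Model m × Model m => 2 * l q.2 * (localRep F x q)⁻¹) (y₀, v) := by
      refine DifferentiableAt.mul ?_ (hloc.inv (by rw [hlv]; exact hpos.ne'))
      exact ((l.comp (ContinuousLinearMap.snd ℝ (Model m) (Model m))).differentiableAt).const_mul 2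
    have h3 := h1.mul h2.hasFDerivAt
    refine h3.congr_fderiv ?_
    simp [hlv]
  have hGm : MDifferentiableAt 𝓘(ℝ, Model m × Model m) 𝓘(ℝ, ℝ) G
      (extChartAt (𝓡 (m + 1)).tangent p p) := by
    rw [hself]
    exact hGd.differentiableAt.mdifferentiableAt
  have hcomp := mfderiv_comp p hGm
    (mdifferentiableAt_extChartAt (I := (𝓡 (m + 1)).tangent) (mem_chart_source _ p))
  have hdp := hF.dproj_geodesicField (p := p) hv
  rw [dproj_apply] at hdp
  rw [lieX, hev.mfderiv_eq]
  have h4 := congrArg (fun L => L (geodesicField F p)) hcomp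
  refine h4.trans ?_
  rw [mfderiv_extChartAt_self]
  simp only [mfderiv_eq_fderiv, hself, hGd.fderiv]
  have h5 : l (show Model m × Model m from geodesicField F p).1 = (fiberFun F x v)⁻¹ * l v := by
    rw [hdp]
    exact map_smul l _ _
  have h6 : (2 * l v * (fiberFun F x v)⁻¹) * l (show Model m × Model m from geodesicField F p).1 =
      2 * (l v / fiberFun F x v) ^ 2 := by
    rw [h5]; ring
  exact h6

end LieDerivative

/-! ### The contact volume along a fibre as a Hessian determinant -/

section ContactVolume

open Matrix

/-- Because `H u = 0` and `u · u = 1`, one has `H + u aᵀ = (H + u uᵀ)(1 + u (a - u)ᵀ)`, and the last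
factor has determinant `a · u`. -/
theorem det_add_vecMulVec_of_mulVec_eq_zero {ι : Type*} [Fintype ι] [DecidableEq ι]
    (H : Matrix ι ι ℝ) (u a : ι → ℝ) (hH : H *ᵥ u = 0) (hu : u ⬝ᵥ u = 1) :
    (H + vecMulVec u a).det = (a ⬝ᵥ u) * (H + vecMulVec u u).det := by
  have h : H + vecMulVec u a = (H + vecMulVec u u) * (1 + vecMulVec u (a - u)) := by
    rw [mul_add, mul_one, mul_vecMulVec, add_mulVec, hH, zero_add, vecMulVec_mulVec, hu]
    simp [vecMulVec_sub]
  have h2 : (1 + vecMulVec u (a - u)).det = a ⬝ᵥ u := by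
    rw [vecMulVec_eq Unit, det_one_add_replicateCol_mul_replicateRow, sub_dotProduct, hu]
    ring
  rw [h, det_mul, h2, mul_comm]

variable {m : ℕ}

/-- A unit vector, followed by an orthonormal frame of the tangent space of the sphere there. -/
def adaptedFrame (u : Metric.sphere (0 : Model m) 1) : Fin (m + 1) → Model m :=
  Fin.cons (u : Model m) (sphereFrame u)

theorem orthonormal_adaptedFrame (u : Metric.sphere (0 : Model m) 1) :
    Orthonormal ℝ (adaptedFrame u) := by
  have : Fact (Module.finrank ℝ (Model m) = m + 1) := ⟨finrank_euclideanSpace_fin⟩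
  set b := OrthonormalBasis.fromOrthogonalSpanSingleton (𝕜 := ℝ) m (ne_zero_of_mem_unit_sphere u)
  have hb : ∀ i, sphereFrame u i = (b i : Model m) := fun i => rfl
  have hub : ∀ i, inner ℝ (u : Model m) (b i : Model m) = 0 := fun i =>
    (Submodule.mem_orthogonal_singleton_iff_inner_right.mp (b i).2)
  have hnorm : ‖(u : Model m)‖ = 1 := norm_eq_of_mem_sphere u
  rw [orthonormal_iff_ite]
  intro i j
  refine Fin.cases ?_ (fun i => ?_) i <;> refine Fin.cases ?_ (fun j => ?_) j
  · simp [adaptedFrame, hnorm]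
  · rw [if_neg (Fin.succ_ne_zero j).symm]
    simp [adaptedFrame, hb, hub]
  · simp [adaptedFrame, hb, real_inner_comm, hub, Fin.succ_ne_zero]
  · have := orthonormal_iff_ite.mp b.orthonormal i j
    simpa [adaptedFrame, hb] using this

theorem abs_det_orthonormal {b : Fin (m + 1) → Model m} (hb : Orthonormal ℝ b) :
    |(Matrix.of fun i j => b i j).det| = 1 := by
  set P : Matrix (Fin (m + 1)) (Fin (m + 1)) ℝ := Matrix.of fun i j => b i j
  have h : P * Pᵀ = 1 := by
    ext i j
    have := orthonormal_iff_ite.mp hb i j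
    rw [PiLp.inner_apply] at this
    rw [Matrix.mul_apply, Matrix.one_apply, ← this]
    refine Finset.sum_congr rfl fun k _ => ?_
    simp [P, mul_comm]
  have h2 : P.det * P.det = 1 := by
    have := congrArg Matrix.det h
    rwa [det_mul, det_transpose, det_one] at this
  rcases mul_self_eq_one_iff.mp h2 with h3 | h3 <;> simp [h3]

variable {M : Type*} [TopologicalSpace M] [ChartedSpace (Model m) M]

/-- The matrix of the second derivative of a homogeneous function on the fibre over `x`, made
nondegenerate in the radial direction. -/
def hessMatrix (F : TangentBundle (𝓡 (m + 1)) M → ℝ) (x : M) (u : Model m) :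
    Matrix (Fin (m + 1)) (Fin (m + 1)) ℝ :=
  Matrix.of fun i j => fderiv ℝ (fderiv ℝ (fiberFun F x)) u (EuclideanSpace.single i 1)
    (EuclideanSpace.single j 1) + u i * u j

theorem hessMatrix_neg {F : TangentBundle (𝓡 (m + 1)) M → ℝ} (hrev : IsReversible F) (x : M)
    (u : Model m) :
    hessMatrix F x (-u) = hessMatrix F x u := by
  have heven : ∀ w : Model m, fiberFun F x (-w) = fiberFun F x w := fun w => hrev x w
  ext i j
  simp [hessMatrix, hessian_neg_of_even heven]

variable [IsManifold (𝓡 (m + 1)) ∞ M] {F : TangentBundle (𝓡 (m + 1)) M → ℝ}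

theorem sum_smul_single (w : Model m) :
    ∑ i, w i • (EuclideanSpace.single i 1 : Model m) = w := by
  ext j
  simp [Finset.sum_apply, Pi.single_apply]

theorem contactVolume_splitFrame (hF : IsFinslerMetric F) (x : M)
    (u : Metric.sphere (0 : Model m) 1) :
    contactVolume F ⟨x, (u : Model m)⟩ (splitFrame x u) = m.factorial *
      (Matrix.of fun i j : Fin (m + 1) => Fin.cases
        (fderiv ℝ (fiberFun F x) u (EuclideanSpace.single j 1))
        (fun k => fderiv ℝ (fderiv ℝ (fiberFun F x)) u (sphereFrame u k)
          (EuclideanSpace.single j 1)) i).det := by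
  have hu := ne_zero_of_mem_unit_sphere u
  have hloc := hF.contDiffAt_localRep x hu
  have hfib := (hF.contDiffAt_fiberFun x hu).differentiableAt (by norm_num)
  have h00 : ((0 : Model m), (0 : Model m)) = 0 := rfl
  have h := sum_perm_contact (ι := Fin m)
    (fun o => hilbertForm F ⟨x, (u : Model m)⟩ (splitFrame x u o))
    (fun o o' => dHilbertForm F ⟨x, (u : Model m)⟩ (splitFrame x u o) (splitFrame x u o'))
    (fun i => by
      rw [hilbertForm_apply hfib]
      exact map_zero _)
    (fun i j => by
      rw [dHilbertForm_apply hloc]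
      simp only [splitFrame]
      simp [h00])
    (fun o o' => by
      rw [dHilbertForm_apply hloc, dHilbertForm_apply hloc, neg_sub])
  rw [Fintype.card_fin] at h
  refine h.trans ?_
  congr 1
  rw [← Matrix.det_submatrix_equiv_self (finSuccEquiv m)]
  congr 1
  have hframe : ∀ j : Fin (m + 1),
      splitFrame x u (slotEquiv (Sum.inr (finSuccEquiv m j))) =
        ((EuclideanSpace.single j 1 : Model m), (0 : Model m)) := by
    intro j
    refine Fin.cases ?_ (fun j => ?_) j
    · rw [finSuccEquiv_zero]
      rfl
    · rw [finSuccEquiv_succ]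
      rfl
  ext i j
  simp only [Matrix.submatrix_apply, Matrix.of_apply, hframe]
  refine Fin.cases ?_ (fun i => ?_) i
  · simp only [finSuccEquiv_zero, Option.elim_none, Fin.cases_zero]
    exact hilbertForm_apply hfib _
  · simp only [finSuccEquiv_succ, Option.elim_some, Fin.cases_succ]
    refine (dHilbertForm_apply hloc _ _).trans ?_
    rw [hessian_fiberFun hloc]
    simp only [splitFrame]
    simp [h00]

theorem sum_mul_hessian_add (B : Model m →L[ℝ] Model m →L[ℝ] ℝ) (u w z : Model m) (s : ℝ) :
    ∑ i, w i * (B (EuclideanSpace.single i 1) z + u i * s) = B w z + inner ℝ u w * s := by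
  have h : B w z = ∑ i, w i * B (EuclideanSpace.single i 1) z := by
    have := congrArg (fun y => B.flip z y) (sum_smul_single w)
    simp only [map_sum, map_smul, smul_eq_mul, ContinuousLinearMap.flip_apply] at this
    exact this.symm
  rw [h, PiLp.inner_apply, Finset.sum_mul, ← Finset.sum_add_distrib]
  refine Finset.sum_congr rfl fun i _ => ?_
  simp
  ring

/-- The matrix of the contact volume is an orthogonal matrix, the adapted frame, times `H + u aᵀ`
with `a` the gradient of the metric on the fibre. By Euler's identity `a · u` is the value of the
metric at `u`. Replacing `a` by `u` isolates a factor that depends on the Hessian only. -/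
theorem abs_contactVolume_splitFrame (hF : IsFinslerMetric F) (x : M)
    (u : Metric.sphere (0 : Model m) 1) :
    |contactVolume F ⟨x, (u : Model m)⟩ (splitFrame x u)| =
      m.factorial * (fiberFun F x u * |(hessMatrix F x u).det|) := by
  have hu := ne_zero_of_mem_unit_sphere u
  have hc := hF.contDiffAt_fiberFun x hu
  have hnorm : ‖(u : Model m)‖ = 1 := norm_eq_of_mem_sphere u
  set Φ := fiberFun F x with hΦ
  set H : Matrix (Fin (m + 1)) (Fin (m + 1)) ℝ := Matrix.of fun i j =>
    fderiv ℝ (fderiv ℝ Φ) u (EuclideanSpace.single i 1) (EuclideanSpace.single j 1) with hH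
  set a : Fin (m + 1) → ℝ := fun j => fderiv ℝ Φ u (EuclideanSpace.single j 1) with ha
  have hfac : (Matrix.of fun i j : Fin (m + 1) => Fin.cases
        (fderiv ℝ Φ u (EuclideanSpace.single j 1))
        (fun k => fderiv ℝ (fderiv ℝ Φ) u (sphereFrame u k)
          (EuclideanSpace.single j 1)) i : Matrix (Fin (m + 1)) (Fin (m + 1)) ℝ) =
      (Matrix.of fun i j => adaptedFrame u i j) * (H + vecMulVec (u : Model m) a) := by
    ext i j
    rw [Matrix.mul_apply]
    simp only [Matrix.of_apply, Matrix.add_apply, vecMulVec_apply, hH, ha]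
    rw [sum_mul_hessian_add]
    have hon := orthonormal_iff_ite.mp (orthonormal_adaptedFrame u) 0
    refine Fin.cases ?_ (fun i => ?_) i
    · have h1 : adaptedFrame u 0 = u := rfl
      rw [h1, hessian_symm hc, hessian_apply_self_of_homogeneous (hF.fiberFun_homogeneous x) hc]
      simp [hnorm, hΦ]
    · have h1 : adaptedFrame u i.succ = sphereFrame u i := rfl
      have h2 := hon i.succ
      rw [if_neg (Fin.succ_ne_zero i).symm] at h2
      have h3 : inner ℝ (u : Model m) (adaptedFrame u i.succ) = 0 := h2
      rw [h3, h1]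
      simp [hΦ]
  have hHu : H *ᵥ (u : Model m) = 0 := by
    ext i
    have h1 := hessian_apply_self_of_homogeneous (hF.fiberFun_homogeneous x) hc
      (EuclideanSpace.single i 1)
    conv at h1 => lhs; arg 2; rw [← sum_smul_single (u : Model m)]
    simp only [map_sum, map_smul, smul_eq_mul] at h1
    simp only [Matrix.mulVec, dotProduct, hH, Matrix.of_apply, Pi.zero_apply]
    rw [← h1]
    exact Finset.sum_congr rfl fun k _ => mul_comm _ _
  have huu : (u : Model m) ⬝ᵥ (u : Model m) = 1 := by
    have : inner ℝ (u : Model m) (u : Model m) = 1 := by simp [hnorm]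
    rw [PiLp.inner_apply] at this
    refine Eq.trans ?_ this
    simp [dotProduct, pow_two]
  have hau : a ⬝ᵥ (u : Model m) = Φ u := by
    refine Eq.trans ?_ (fderiv_apply_self_of_homogeneous (hF.fiberFun_homogeneous x)
      (hc.differentiableAt (by norm_num)))
    conv_rhs => arg 2; rw [← sum_smul_single (u : Model m)]
    simp only [map_sum, map_smul, smul_eq_mul, dotProduct, ha]
    exact Finset.sum_congr rfl fun k _ => mul_comm _ _
  have hM : hessMatrix F x u = H + vecMulVec (u : Model m) (u : Model m) := by
    ext i j
    simp [hessMatrix, hH, vecMulVec_apply, hΦ]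
  rw [contactVolume_splitFrame hF, hfac, det_mul,
    det_add_vecMulVec_of_mulVec_eq_zero H _ a hHu huu, hau, ← hM, abs_mul, abs_mul, abs_mul,
    abs_det_orthonormal (orthonormal_adaptedFrame u), one_mul, abs_of_pos (hF.fiberFun_pos x hu),
    Nat.abs_cast]

/-- For a null vector `W`, the Hessian at `(W, W)` and the square of the inner product of `u` and
`W` are nonnegative with zero sum. Hence `W` is both radial and orthogonal to `u`. -/
theorem det_hessMatrix_ne_zero (hF : IsFinslerMetric F) (x : M) {u : Model m} (hu : u ≠ 0) :
    (hessMatrix F x u).det ≠ 0 := by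
  have hc := hF.contDiffAt_fiberFun x hu
  intro h
  obtain ⟨w, hw0, hw⟩ := Matrix.exists_vecMul_eq_zero_iff.mpr h
  set W : Model m := WithLp.toLp 2 w with hW
  have hWi : ∀ i, W i = w i := fun i => rfl
  have hW0 : W ≠ 0 := by
    intro h0
    apply hw0
    ext i
    rw [← hWi, h0]
    rfl
  have hj : ∀ j, fderiv ℝ (fderiv ℝ (fiberFun F x)) u W (EuclideanSpace.single j 1) +
      inner ℝ u W * u j = 0 := by
    intro j
    have h1 := congrFun hw j
    simp only [Matrix.vecMul, dotProduct, hessMatrix, Matrix.of_apply, Pi.zero_apply] at h1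
    rw [← sum_mul_hessian_add]
    exact h1
  have hq : fderiv ℝ (fderiv ℝ (fiberFun F x)) u W W + inner ℝ u W ^ 2 = 0 := by
    have h1 : ∑ j, W j * (fderiv ℝ (fderiv ℝ (fiberFun F x)) u W (EuclideanSpace.single j 1) +
      inner ℝ u W * u j) = 0 := Finset.sum_eq_zero fun j _ => by rw [hj, mul_zero]
    have h2 : ∀ L : Model m →L[ℝ] ℝ, L W = ∑ j, W j * L (EuclideanSpace.single j 1) := by
      intro L
      conv_lhs => rw [← sum_smul_single W]
      simp only [map_sum, map_smul, smul_eq_mul]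
    rw [h2 (fderiv ℝ (fderiv ℝ (fiberFun F x)) u W), sq]
    nth_rewrite 1 [PiLp.inner_apply]
    rw [Finset.sum_mul, ← Finset.sum_add_distrib, ← h1]
    refine Finset.sum_congr rfl fun i _ => ?_
    simp
    ring
  obtain ⟨h0, h1⟩ := hessian_pos_of_stronglyConvex (hF.fiberFun_homogeneous x) hc
    (hF.fiberFun_pos x hu) (fun w hw => hF.stronglyConvex x u w hu hw) W
  have hsq := sq_nonneg (inner ℝ u W)
  obtain ⟨c, hcW⟩ := h1 (by linarith)
  have hin : inner ℝ u W = 0 := by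
    have : inner ℝ u W ^ 2 = 0 := by linarith
    simpa using this
  rw [hcW, inner_smul_right, mul_eq_zero] at hin
  rcases hin with hin | hin
  · exact hW0 (by rw [hcW, hin, zero_smul])
  · exact hu (inner_self_eq_zero.mp hin)

theorem continuous_det_hessMatrix (hF : IsFinslerMetric F) (x : M) :
    Continuous fun u : Metric.sphere (0 : Model m) 1 => (hessMatrix F x u).det := by
  refine Continuous.matrix_det (continuous_matrix fun i j => ?_)
  have h1 : Continuous fun u : Metric.sphere (0 : Model m) 1 =>
      fderiv ℝ (fderiv ℝ (fiberFun F x)) (u : Model m) := by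
    rw [continuous_iff_continuousAt]
    intro u
    have h := ((hF.contDiffAt_fiberFun x (ne_zero_of_mem_unit_sphere u)).fderiv_right
      (m := 1) (by norm_num)).fderiv_right (m := 0) (by norm_num)
    exact h.continuousAt.comp continuous_subtype_val.continuousAt
  refine Continuous.add ((h1.clm_apply continuous_const).clm_apply continuous_const) ?_
  exact ((EuclideanSpace.proj (𝕜 := ℝ) i).continuous.comp continuous_subtype_val).mul
    ((EuclideanSpace.proj (𝕜 := ℝ) j).continuous.comp continuous_subtype_val)

theorem hessMatrix_addOneForm (hF : IsFinslerMetric F)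
    (β : ∀ x : M, TangentSpace (𝓡 (m + 1)) x →L[ℝ] ℝ) (x : M) {u : Model m} (hu : u ≠ 0) :
    hessMatrix (addOneForm F β) x u = hessMatrix F x u := by
  ext i j
  simp only [hessMatrix, hF.hessian_fiberFun_addOneForm β x hu]

end ContactVolume

/-! ### Symmetry and null sets of the sphere measure -/

section SphereMeasure

variable {m : ℕ}

/-- The surface measure of the unit sphere of the model space. -/
def surf (m : ℕ) : Measure (Metric.sphere (0 : Model m) 1) := (volume : Measure (Model m)).toSphere

instance : IsFiniteMeasure (surf m) :=
  inferInstanceAs (IsFiniteMeasure (volume : Measure (Model m)).toSphere)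

instance : (surf m).IsOpenPosMeasure :=
  inferInstanceAs (volume : Measure (Model m)).toSphere.IsOpenPosMeasure

theorem nonempty_unitSphere : Nonempty (Metric.sphere (0 : Model m) 1) :=
  (NormedSpace.sphere_nonempty.mpr zero_le_one).to_subtype

/-- The surface measure of a set is a multiple of the volume of the cone over it, and Lebesgue
measure is invariant under negation. -/
theorem measurePreserving_neg_surf :
    MeasurePreserving (fun u : Metric.sphere (0 : Model m) 1 => -u) (surf m) (surf m) := by
  have hmeas : Measurable (fun u : Metric.sphere (0 : Model m) 1 => -u) := continuous_neg.measurable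
  refine ⟨hmeas, ?_⟩
  ext s hs
  rw [Measure.map_apply hmeas hs, surf, Measure.toSphere_apply' _ (hmeas hs),
    Measure.toSphere_apply' _ hs]
  congr 1
  rw [← Measure.measure_neg]
  congr 1
  ext v
  simp only [Set.mem_neg, Set.mem_smul, Set.mem_image, Set.mem_preimage]
  constructor
  · rintro ⟨r, hr, _, ⟨u, hu, rfl⟩, h⟩
    exact ⟨r, hr, _, ⟨-u, hu, rfl⟩, by simp [h]⟩
  · rintro ⟨r, hr, _, ⟨u, hu, rfl⟩, h⟩
    exact ⟨r, hr, _, ⟨-u, by simpa using hu, rfl⟩, by simp [h]⟩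

theorem integral_comp_neg_surf (f : Metric.sphere (0 : Model m) 1 → ℝ) :
    ∫ u, f (-u) ∂(surf m) = ∫ u, f u ∂(surf m) :=
  measurePreserving_neg_surf.integral_comp (Homeomorph.neg _).measurableEmbedding f

/-- The cone over the equator lies in a proper subspace, which has Lebesgue measure zero. -/
theorem surf_setOf_eq_zero {l : Model m →L[ℝ] ℝ} (hl : l ≠ 0) :
    surf m {u | l (u : Model m) = 0} = 0 := by
  have hmeas : MeasurableSet {u : Metric.sphere (0 : Model m) 1 | l (u : Model m) = 0} :=
    (isClosed_eq (l.continuous.comp continuous_subtype_val) continuous_const).measurableSet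
  rw [surf, Measure.toSphere_apply' _ hmeas]
  have h0 : (volume : Measure (Model m)) (LinearMap.ker l.toLinearMap : Set (Model m)) = 0 := by
    apply Measure.addHaar_submodule
    intro h
    apply hl
    ext v
    have : v ∈ LinearMap.ker l.toLinearMap := h ▸ Submodule.mem_top
    simpa using this
  rw [measure_mono_null _ h0, mul_zero]
  rintro _ ⟨r, -, _, ⟨u, hu, rfl⟩, rfl⟩
  have hu' : l (u : Model m) = 0 := hu
  simp [hu']

theorem integrable_surf {f : Metric.sphere (0 : Model m) 1 → ℝ} (hf : Continuous f) :
    Integrable f (surf m) :=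
  hf.integrable_of_hasCompactSupport (HasCompactSupport.of_compactSpace f)

theorem integral_surf_pos {f : Metric.sphere (0 : Model m) 1 → ℝ} (hf : Continuous f)
    (hpos : ∀ u, 0 < f u) : 0 < ∫ u, f u ∂(surf m) := by
  rw [integral_pos_iff_support_of_nonneg (fun u => (hpos u).le) (integrable_surf hf)]
  have : Function.support f = Set.univ := by
    ext u; simp [(hpos u).ne']
  rw [this]
  have := nonempty_unitSphere (m := m)
  exact isOpen_univ.measure_pos _ Set.univ_nonempty

theorem integral_surf_eq_zero_iff {f : Metric.sphere (0 : Model m) 1 → ℝ} (hf : Continuous f)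
    (hpos : ∀ u, 0 ≤ f u) : ∫ u, f u ∂(surf m) = 0 ↔ ∀ u, f u = 0 := by
  rw [integral_eq_zero_iff_of_nonneg hpos (integrable_surf hf),
    hf.ae_eq_iff_eq (surf m) continuous_zero, funext_iff]
  rfl

/-- The integral of an even function over the half-sphere where a linear form is nonnegative. -/
theorem two_mul_integral_halfSphere {l : Model m →L[ℝ] ℝ} (hl : l ≠ 0)
    {h : Metric.sphere (0 : Model m) 1 → ℝ} (hc : Continuous h) (heven : ∀ u, h (-u) = h u) :
    2 * ∫ u, {u : Metric.sphere (0 : Model m) 1 | 0 ≤ l (u : Model m)}.indicator h u ∂(surf m) =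
      ∫ u, h u ∂(surf m) := by
  have hlc : Continuous fun u : Metric.sphere (0 : Model m) 1 => l (u : Model m) :=
    l.continuous.comp continuous_subtype_val
  have hp : MeasurableSet {u : Metric.sphere (0 : Model m) 1 | 0 ≤ l (u : Model m)} :=
    (isClosed_le continuous_const hlc).measurableSet
  have hn : MeasurableSet {u : Metric.sphere (0 : Model m) 1 | l (u : Model m) ≤ 0} :=
    (isClosed_le hlc continuous_const).measurableSet
  have h1 : ∫ u, {u : Metric.sphere (0 : Model m) 1 | l (u : Model m) ≤ 0}.indicator h u ∂(surf m) =
      ∫ u, {u : Metric.sphere (0 : Model m) 1 | 0 ≤ l (u : Model m)}.indicator h u ∂(surf m) := by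
    rw [← integral_comp_neg_surf]
    refine integral_congr_ae (Filter.Eventually.of_forall fun u => ?_)
    simp [Set.indicator, heven]
  have h2 : ∫ u, h u ∂(surf m) =
      ∫ u, ({u : Metric.sphere (0 : Model m) 1 | 0 ≤ l (u : Model m)}.indicator h u +
        {u : Metric.sphere (0 : Model m) 1 | l (u : Model m) ≤ 0}.indicator h u) ∂(surf m) := by
    refine integral_congr_ae ?_
    have h0 : ∀ᵐ u : Metric.sphere (0 : Model m) 1 ∂(surf m), l (u : Model m) ≠ 0 := by
      have h3 := surf_setOf_eq_zero hl
      rw [ae_iff]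
      simpa only [ne_eq, not_not] using h3
    filter_upwards [h0] with u hu
    rcases lt_or_gt_of_ne hu with h | h
    · simp [Set.indicator, h.le, h.not_ge]
    · simp [Set.indicator, h.le, h.not_ge]
  rw [h2, integral_add ((integrable_surf hc).indicator hp) ((integrable_surf hc).indicator hn), h1,
    two_mul]

/-- A vector space is not the union of two proper subspaces: if `l v ≠ 0` and `b w ≠ 0`, then the
product is nonzero at `v + w`. -/
theorem eq_zero_or_eq_zero_of_mul_sphere {l b : Model m →L[ℝ] ℝ}
    (h : ∀ u : Metric.sphere (0 : Model m) 1, l (u : Model m) * b (u : Model m) = 0) :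
    l = 0 ∨ b = 0 := by
  have hall : ∀ v : Model m, l v * b v = 0 := by
    intro v
    by_cases hv : v = 0
    · simp [hv]
    have hn : ‖v‖ ≠ 0 := norm_ne_zero_iff.mpr hv
    have := h ⟨‖v‖⁻¹ • v, by simp [norm_smul, hn]⟩
    simp only [map_smul, smul_eq_mul] at this
    have h2 : (‖v‖⁻¹ * ‖v‖⁻¹) * (l v * b v) = 0 := by linarith
    exact (mul_eq_zero.mp h2).resolve_left (mul_ne_zero (inv_ne_zero hn) (inv_ne_zero hn))
  by_contra hne
  push Not at hne
  obtain ⟨v, hv⟩ := DFunLike.ne_iff.mp hne.1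
  obtain ⟨w, hw⟩ := DFunLike.ne_iff.mp hne.2
  have hbv : b v = 0 := (mul_eq_zero.mp (hall v)).resolve_left hv
  have hlw : l w = 0 := (mul_eq_zero.mp (hall w)).resolve_right hw
  have h3 := hall (v + w)
  rw [map_add, map_add, hbv, hlw, add_zero, zero_add] at h3
  exact mul_ne_zero hv hw h3

end SphereMeasure

/-! ### The angle measure and the symbol as sphere integrals -/

section AngleIntegral

variable {m : ℕ} {M : Type*} [TopologicalSpace M] [ChartedSpace (Model m) M]

/-- The `σ`-algebra on the fibre is by definition the one pushed forward by `direction`, so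
injectivity suffices. -/
theorem measurableEmbedding_direction (x : M) :
    MeasurableEmbedding (direction (m := m) x) := by
  have hinj : Function.Injective (direction (m := m) x) := by
    intro u w h
    have h1 : SameRay ℝ (u : Model m) (w : Model m) :=
      (ray_eq_iff (R := ℝ) (M := Model m) (ne_zero_of_mem_unit_sphere u)
        (ne_zero_of_mem_unit_sphere w)).mp h
    ext1
    exact (sameRay_iff_of_norm_eq ((norm_eq_of_mem_sphere u).trans
      (norm_eq_of_mem_sphere w).symm)).mp h1
  refine ⟨hinj, fun s hs => hs, fun {s} hs => ?_⟩
  change MeasurableSet (direction x ⁻¹' (direction x '' s))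
  rwa [Set.preimage_image_eq s hinj]

/-- The representative of a ray is an arbitrary choice. Integrands are homogeneous of degree zero,
so knowing it up to a positive factor is enough. -/
theorem exists_vec_direction (x : M) (u : Metric.sphere (0 : Model m) 1) :
    ∃ c : ℝ, 0 < c ∧ (direction x u).vec = (c • (u : Model m) : Model m) := by
  let r : Module.Ray ℝ (Model m) := direction x u
  have h1 : SameRay ℝ (u : Model m) r.someVector :=
    (ray_eq_iff (ne_zero_of_mem_unit_sphere u) r.someVector_ne_zero).mp r.someVector_ray.symm
  obtain ⟨c, hc, h2⟩ := h1.exists_pos_left (ne_zero_of_mem_unit_sphere u) r.someVector_ne_zero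
  exact ⟨c, hc, h2.symm⟩

variable [IsManifold (𝓡 (m + 1)) ∞ M] {F : TangentBundle (𝓡 (m + 1)) M → ℝ}

/-- The density of the contact volume along the fibre over `x`, relative to the surface measure. -/
def angleDensity (F : TangentBundle (𝓡 (m + 1)) M → ℝ) (x : M)
    (u : Metric.sphere (0 : Model m) 1) : ℝ :=
  m.factorial * (fiberFun F x u * |(hessMatrix F x u).det|)

theorem continuous_angleDensity (hF : IsFinslerMetric F) (x : M) :
    Continuous (angleDensity F x) :=
  continuous_const.mul (((hF.continuous_fiberFun x).comp continuous_subtype_val).mul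
    (continuous_det_hessMatrix hF x).abs)

theorem angleDensity_pos (hF : IsFinslerMetric F) (x : M) (u : Metric.sphere (0 : Model m) 1) :
    0 < angleDensity F x u := by
  have hu := ne_zero_of_mem_unit_sphere u
  have h1 := hF.fiberFun_pos x hu
  have h2 := abs_pos.mpr (det_hessMatrix_ne_zero hF x hu)
  have h3 : (0 : ℝ) < m.factorial := by exact_mod_cast m.factorial_pos
  rw [angleDensity]
  positivity

theorem verticalMeasure_eq (hF : IsFinslerMetric F) (x : M) :
    verticalMeasure F x = Measure.map (direction x)
      ((surf m).withDensity fun u => ENNReal.ofReal (angleDensity F x u)) := by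
  rw [verticalMeasure]
  congr 2
  ext u
  rw [abs_contactVolume_splitFrame hF, angleDensity]

theorem verticalMeasure_univ (hF : IsFinslerMetric F) (x : M) :
    verticalMeasure F x Set.univ = ENNReal.ofReal (∫ u, angleDensity F x u ∂(surf m)) := by
  rw [verticalMeasure_eq hF, (measurableEmbedding_direction x).map_apply, Set.preimage_univ,
    withDensity_apply _ MeasurableSet.univ, Measure.restrict_univ,
    ofReal_integral_eq_lintegral_ofReal (integrable_surf (continuous_angleDensity hF x))
      (Filter.Eventually.of_forall fun u => (angleDensity_pos hF x u).le)]

/-- Integration against the angle measure, in the parametrization by the Euclidean sphere. -/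
theorem integral_angleMeasure (hF : IsFinslerMetric F) (x : M) (g : HFiber m x → ℝ) :
    ∫ ξ, g ξ ∂(angleMeasure F x) = (sphereVol m).toReal / (∫ u, angleDensity F x u ∂(surf m)) *
      ∫ u, angleDensity F x u * g (direction x u) ∂(surf m) := by
  have hpos := integral_surf_pos (continuous_angleDensity hF x) (angleDensity_pos hF x)
  rw [angleMeasure, integral_smul_measure, ENNReal.toReal_div, verticalMeasure_univ hF,
    ENNReal.toReal_ofReal hpos.le, smul_eq_mul, verticalMeasure_eq hF,
    (measurableEmbedding_direction x).integral_map,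
    integral_withDensity_eq_integral_toReal_smul
      (continuous_angleDensity hF x).measurable.ennreal_ofReal
      (Filter.Eventually.of_forall fun u => ENNReal.ofReal_lt_top)]
  congr 1
  refine integral_congr_ae (Filter.Eventually.of_forall fun u => ?_)
  simp [ENNReal.toReal_ofReal (angleDensity_pos hF x u).le]

theorem sphereVol_toReal_pos (m : ℕ) : 0 < (sphereVol m).toReal := by
  have h : sphereVol m = surf m Set.univ := rfl
  have := nonempty_unitSphere (m := m)
  rw [h]
  exact ENNReal.toReal_pos (isOpen_univ.measure_pos _ Set.univ_nonempty).ne' (measure_ne_top _ _)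

theorem IsFinslerMetric.div_fiberFun_smul (hF : IsFinslerMetric F) (x : M) (l : Model m →L[ℝ] ℝ)
    {c : ℝ} (hc : 0 < c) (v : Model m) :
    l (c • v) / fiberFun F x (c • v) = l v / fiberFun F x v := by
  rw [hF.fiberFun_homogeneous x v c hc, map_smul, smul_eq_mul, mul_div_mul_left _ _ (ne_of_gt hc)]

/-- The symbol of the Bourguignon-Foulon Laplacian as an integral over the Euclidean sphere. -/
theorem principalSymbol_bfLaplacian (hF : IsFinslerMetric F) (x : M) (l : Model m →L[ℝ] ℝ) :
    principalSymbol (bfLaplacian F) x l l =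
      ((m : ℝ) + 1) / (∫ u, angleDensity F x u ∂(surf m)) *
        ∫ u, angleDensity F x u * (l (u : Model m) / fiberFun F x u) ^ 2 ∂(surf m) := by
  have hval : ∀ u : Metric.sphere (0 : Model m) 1, (direction x u).val
      (lieX F (lieX F (pull fun y => coordFun x l y * coordFun x l y))) =
      2 * (l (u : Model m) / fiberFun F x u) ^ 2 := by
    intro u
    obtain ⟨c, hc, h⟩ := exists_vec_direction x u
    rw [HFiber.val, h]
    refine (hF.lieX_lieX_pull_coordFun x l
      (smul_ne_zero hc.ne' (ne_zero_of_mem_unit_sphere u))).trans ?_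
    rw [hF.div_fiberFun_smul x l hc]
  change (1 / 2 : ℝ) * bfLaplacian F (fun y => coordFun x l y * coordFun x l y) x = _
  rw [bfLaplacian, integral_angleMeasure hF]
  simp_rw [hval]
  have h2 : ∀ u : Metric.sphere (0 : Model m) 1,
      angleDensity F x u * (2 * (l (u : Model m) / fiberFun F x u) ^ 2) =
      2 * (angleDensity F x u * (l (u : Model m) / fiberFun F x u) ^ 2) := fun u => by ring
  simp_rw [h2]
  rw [integral_const_mul]
  have h3 := (sphereVol_toReal_pos m).ne'
  field_simp

end AngleIntegral

/-! ### Comparison of the two symbols -/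

section Comparison

variable {m : ℕ} {M : Type*} [TopologicalSpace M] [ChartedSpace (Model m) M]

/-- The density of the contact volume divided by the metric. -/
def reducedDensity (F : TangentBundle (𝓡 (m + 1)) M → ℝ) (x : M)
    (u : Metric.sphere (0 : Model m) 1) : ℝ :=
  m.factorial * |(hessMatrix F x u).det|

theorem angleDensity_eq (F : TangentBundle (𝓡 (m + 1)) M → ℝ) (x : M)
    (u : Metric.sphere (0 : Model m) 1) :
    angleDensity F x u = fiberFun F x u * reducedDensity F x u := by
  rw [angleDensity, reducedDensity]
  ring

theorem reducedDensity_neg {F : TangentBundle (𝓡 (m + 1)) M → ℝ}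
    (hrev : IsReversible F) (x : M) (u : Metric.sphere (0 : Model m) 1) :
    reducedDensity F x (-u) = reducedDensity F x u := by
  rw [reducedDensity, reducedDensity]
  have : ((-u : Metric.sphere (0 : Model m) 1) : Model m) = -(u : Model m) := rfl
  rw [this, hessMatrix_neg hrev]

/-- The even part of the integrand of the symbol of `F + β`. -/
def symbolIntegrand (F : TangentBundle (𝓡 (m + 1)) M → ℝ)
    (β : ∀ x : M, TangentSpace (𝓡 (m + 1)) x →L[ℝ] ℝ) (x : M) (l : Model m →L[ℝ] ℝ)
    (u : Metric.sphere (0 : Model m) 1) : ℝ :=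
  reducedDensity F x u * l (u : Model m) ^ 2 * fiberFun F x u /
    (fiberFun F x u ^ 2 - modelForm β x u ^ 2)

theorem symbolIntegrand_neg {F : TangentBundle (𝓡 (m + 1)) M → ℝ}
    {β : ∀ x : M, TangentSpace (𝓡 (m + 1)) x →L[ℝ] ℝ} (hrev : IsReversible F) (x : M)
    (l : Model m →L[ℝ] ℝ) (u : Metric.sphere (0 : Model m) 1) :
    symbolIntegrand F β x l (-u) = symbolIntegrand F β x l u := by
  have heven : fiberFun F x (-(u : Model m)) = fiberFun F x u := hrev x _
  simp only [symbolIntegrand, reducedDensity_neg hrev, coe_neg_sphere, map_neg, heven, even_two,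
    Even.neg_pow]

variable [IsManifold (𝓡 (m + 1)) ∞ M] {F : TangentBundle (𝓡 (m + 1)) M → ℝ}

theorem continuous_reducedDensity (hF : IsFinslerMetric F) (x : M) :
    Continuous (reducedDensity F x) :=
  continuous_const.mul (continuous_det_hessMatrix hF x).abs

theorem reducedDensity_pos (hF : IsFinslerMetric F) (x : M) (u : Metric.sphere (0 : Model m) 1) :
    0 < reducedDensity F x u := by
  have h := angleDensity_pos hF x u
  rw [angleDensity_eq] at h
  exact (mul_pos_iff_of_pos_left (hF.fiberFun_pos x (ne_zero_of_mem_unit_sphere u))).mp h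

theorem reducedDensity_addOneForm (hF : IsFinslerMetric F)
    (β : ∀ x : M, TangentSpace (𝓡 (m + 1)) x →L[ℝ] ℝ) (x : M)
    (u : Metric.sphere (0 : Model m) 1) :
    reducedDensity (addOneForm F β) x u = reducedDensity F x u := by
  rw [reducedDensity, reducedDensity, hessMatrix_addOneForm hF β x (ne_zero_of_mem_unit_sphere u)]

variable {β : ∀ x : M, TangentSpace (𝓡 (m + 1)) x →L[ℝ] ℝ}

theorem continuous_clm_sphere (l : Model m →L[ℝ] ℝ) :
    Continuous fun u : Metric.sphere (0 : Model m) 1 => l (u : Model m) :=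
  l.continuous.comp continuous_subtype_val

theorem IsFinslerMetric.continuous_fiberFun_sphere (hF : IsFinslerMetric F) (x : M) :
    Continuous fun u : Metric.sphere (0 : Model m) 1 => fiberFun F x (u : Model m) :=
  (hF.continuous_fiberFun x).comp continuous_subtype_val

/-- The total contact volume of a fibre does not change when a one-form is added to a reversible
metric. -/
theorem integral_angleDensity_addOneForm (hF : IsFinslerMetric F) (hrev : IsReversible F)
    (β : ∀ x : M, TangentSpace (𝓡 (m + 1)) x →L[ℝ] ℝ) (x : M) :
    ∫ u, angleDensity (addOneForm F β) x u ∂(surf m) = ∫ u, angleDensity F x u ∂(surf m) := by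
  have h1 : ∀ u : Metric.sphere (0 : Model m) 1, angleDensity (addOneForm F β) x u =
      angleDensity F x u + modelForm β x u * reducedDensity F x u := by
    intro u
    rw [angleDensity_eq, reducedDensity_addOneForm hF, fiberFun_addOneForm, angleDensity_eq]
    ring
  have h2 : ∫ u, modelForm β x (u : Model m) * reducedDensity F x u ∂(surf m) = 0 := by
    have h := integral_comp_neg_surf
      (fun u : Metric.sphere (0 : Model m) 1 => modelForm β x (u : Model m) * reducedDensity F x u)
    simp only [reducedDensity_neg hrev, coe_neg_sphere, map_neg, neg_mul, integral_neg] at h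
    linarith
  have hi : Integrable (fun u : Metric.sphere (0 : Model m) 1 =>
      modelForm β x (u : Model m) * reducedDensity F x u) (surf m) :=
    integrable_surf ((continuous_clm_sphere _).mul (continuous_reducedDensity hF x))
  simp_rw [h1]
  rw [integral_add (integrable_surf (continuous_angleDensity hF x)) hi, h2, add_zero]

theorem sq_sub_sq_pos {a b : ℝ} (h : |b| < a) : 0 < a ^ 2 - b ^ 2 := by
  have := abs_lt.mp h
  nlinarith

theorem continuous_symbolIntegrand (hF : IsFinslerMetric F) {x : M}
    (hβ : ∀ v : Model m, v ≠ 0 → |modelForm β x v| < fiberFun F x v) (l : Model m →L[ℝ] ℝ) :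
    Continuous (symbolIntegrand F β x l) := by
  refine Continuous.div ?_ ?_ fun u => (sq_sub_sq_pos (hβ u (ne_zero_of_mem_unit_sphere u))).ne'
  · exact ((continuous_reducedDensity hF x).mul ((continuous_clm_sphere l).pow 2)).mul
      (hF.continuous_fiberFun_sphere x)
  · exact ((hF.continuous_fiberFun_sphere x).pow 2).sub ((continuous_clm_sphere _).pow 2)

/-- The integrand is `ρ l² / (F + β)` with `ρ` the reduced density. Replacing it by its even part
does not change the integral, and `1 / (F + β) + 1 / (F - β) = 2 F / (F² - β²)`. -/
theorem principalSymbol_addOneForm (hF : IsFinslerMetric F) (hrev : IsReversible F)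
    (hF' : IsFinslerMetric (addOneForm F β)) {x : M}
    (hβ : ∀ v : Model m, v ≠ 0 → |modelForm β x v| < fiberFun F x v) (l : Model m →L[ℝ] ℝ) :
    principalSymbol (bfLaplacian (addOneForm F β)) x l l =
      ((m : ℝ) + 1) / (∫ u, angleDensity F x u ∂(surf m)) *
        ∫ u, symbolIntegrand F β x l u ∂(surf m) := by
  rw [principalSymbol_bfLaplacian hF', integral_angleDensity_addOneForm hF hrev]
  congr 1
  set g : Metric.sphere (0 : Model m) 1 → ℝ := fun u =>
    angleDensity (addOneForm F β) x u * (l (u : Model m) / fiberFun (addOneForm F β) x u) ^ 2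
    with hg
  have hgc : Continuous g := (continuous_angleDensity hF' x).mul
    (((continuous_clm_sphere l).div (hF'.continuous_fiberFun_sphere x)
      fun u => (hF'.fiberFun_pos x (ne_zero_of_mem_unit_sphere u)).ne').pow 2)
  have hsum : ∀ u, g u + g (-u) = 2 * symbolIntegrand F β x l u := by
    intro u
    have hu := ne_zero_of_mem_unit_sphere u
    have heven : fiberFun F x (-(u : Model m)) = fiberFun F x u := hrev x _
    have hab := abs_lt.mp (hβ u hu)
    have h1 : fiberFun F x u + modelForm β x u ≠ 0 := by linarith
    have h2 : fiberFun F x u + -modelForm β x u ≠ 0 := by linarith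
    have h3 : fiberFun F x u ^ 2 - modelForm β x u ^ 2 ≠ 0 := (sq_sub_sq_pos (hβ u hu)).ne'
    simp only [hg, angleDensity_eq, reducedDensity_addOneForm hF, reducedDensity_neg hrev,
      coe_neg_sphere, fiberFun_addOneForm, map_neg, heven, symbolIntegrand]
    field_simp
    ring
  have h := integral_comp_neg_surf g
  have hintegral : ∫ u, (g u + g (-u)) ∂(surf m) = 2 * ∫ u, symbolIntegrand F β x l u ∂(surf m) := by
    simp_rw [hsum]
    rw [integral_const_mul]
  have hi : Integrable (fun u => g (-u)) (surf m) := integrable_surf (hgc.comp continuous_neg)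
  rw [integral_add (integrable_surf hgc) hi, h] at hintegral
  linarith

/-- Both symbols carry the same constant, so only the integrands are compared. They differ by a
positive multiple of `(l β)²`, continuous on the sphere. -/
theorem principalSymbol_sub (hF : IsFinslerMetric F) (hrev : IsReversible F)
    (hF' : IsFinslerMetric (addOneForm F β)) {x : M}
    (hβ : ∀ v : Model m, v ≠ 0 → |modelForm β x v| < fiberFun F x v) (l : Model m →L[ℝ] ℝ) :
    principalSymbol (bfLaplacian F) x l l ≤ principalSymbol (bfLaplacian (addOneForm F β)) x l l ∧
    (principalSymbol (bfLaplacian (addOneForm F β)) x l l = principalSymbol (bfLaplacian F) x l l ↔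
      l = 0 ∨ modelForm β x = 0) := by
  have hK := integral_surf_pos (continuous_angleDensity hF x) (angleDensity_pos hF x)
  set g : Metric.sphere (0 : Model m) 1 → ℝ := fun u =>
    angleDensity F x u * (l (u : Model m) / fiberFun F x u) ^ 2 with hg
  have hgc : Continuous g := (continuous_angleDensity hF x).mul
    (((continuous_clm_sphere l).div (hF.continuous_fiberFun_sphere x)
      fun u => (hF.fiberFun_pos x (ne_zero_of_mem_unit_sphere u)).ne').pow 2)
  have hsc := continuous_symbolIntegrand hF hβ l
  have hdiff : ∀ u : Metric.sphere (0 : Model m) 1, symbolIntegrand F β x l u - g u =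
      (reducedDensity F x u / (fiberFun F x u * (fiberFun F x u ^ 2 - modelForm β x u ^ 2))) *
        (l (u : Model m) * modelForm β x u) ^ 2 := by
    intro u
    have hu := ne_zero_of_mem_unit_sphere u
    have h1 := (hF.fiberFun_pos x hu).ne'
    have h3 : fiberFun F x u ^ 2 - modelForm β x u ^ 2 ≠ 0 := (sq_sub_sq_pos (hβ u hu)).ne'
    simp only [hg, angleDensity_eq, symbolIntegrand]
    field_simp
    ring
  have hcoef : ∀ u : Metric.sphere (0 : Model m) 1, 0 < reducedDensity F x u /
      (fiberFun F x u * (fiberFun F x u ^ 2 - modelForm β x u ^ 2)) := fun u =>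
    div_pos (reducedDensity_pos hF x u) (mul_pos
      (hF.fiberFun_pos x (ne_zero_of_mem_unit_sphere u))
      (sq_sub_sq_pos (hβ u (ne_zero_of_mem_unit_sphere u))))
  have hnonneg : ∀ u, 0 ≤ symbolIntegrand F β x l u - g u := fun u => by
    rw [hdiff]
    exact mul_nonneg (hcoef u).le (sq_nonneg _)
  have hsub : principalSymbol (bfLaplacian (addOneForm F β)) x l l -
      principalSymbol (bfLaplacian F) x l l =
      ((m : ℝ) + 1) / (∫ u, angleDensity F x u ∂(surf m)) *
        ∫ u, (symbolIntegrand F β x l u - g u) ∂(surf m) := by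
    rw [principalSymbol_addOneForm hF hrev hF' hβ, principalSymbol_bfLaplacian hF,
      integral_sub (integrable_surf hsc) (integrable_surf hgc), mul_sub]
  have hcst : 0 < ((m : ℝ) + 1) / (∫ u, angleDensity F x u ∂(surf m)) :=
    div_pos (by positivity) hK
  have hcd : Continuous fun u => symbolIntegrand F β x l u - g u := hsc.sub hgc
  constructor
  · rw [← sub_nonneg, hsub]
    exact mul_nonneg hcst.le (integral_nonneg hnonneg)
  · rw [← sub_eq_zero, hsub, mul_eq_zero, or_iff_right hcst.ne',
      integral_surf_eq_zero_iff hcd hnonneg]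
    constructor
    · intro h
      apply eq_zero_or_eq_zero_of_mul_sphere
      intro u
      have h1 := h u
      rw [hdiff, mul_eq_zero, or_iff_right (hcoef u).ne'] at h1
      simpa using h1
    · rintro (h | h) u <;> rw [hdiff, h] <;> simp

theorem principalSymbol_nonneg (hF : IsFinslerMetric F) (x : M) (l : Model m →L[ℝ] ℝ) :
    0 ≤ principalSymbol (bfLaplacian F) x l l := by
  rw [principalSymbol_bfLaplacian hF]
  have hK := integral_surf_pos (continuous_angleDensity hF x) (angleDensity_pos hF x)
  exact mul_nonneg (div_nonneg (by positivity) hK.le)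
    (integral_nonneg fun u => mul_nonneg (angleDensity_pos hF x u).le (sq_nonneg _))

theorem val_oneFormX (hF : IsFinslerMetric F) (x : M) (u : Metric.sphere (0 : Model m) 1) :
    (direction x u).val (oneFormX F β) = modelForm β x u / fiberFun F x u := by
  obtain ⟨c, hc, h⟩ := exists_vec_direction x u
  have hne : (c • (u : Model m) : Model m) ≠ 0 :=
    smul_ne_zero hc.ne' (ne_zero_of_mem_unit_sphere u)
  rw [HFiber.val, h, oneFormX, hF.dproj_geodesicField (p := ⟨x, (c • (u : Model m) : Model m)⟩) hne,
    map_smul, ← hF.div_fiberFun_smul x (modelForm β x) hc, div_eq_inv_mul]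
  rfl

theorem val_lieX_pull (hF : IsFinslerMetric F) (x : M) {f : M → ℝ}
    (hf : MDifferentiableAt (𝓡 (m + 1)) 𝓘(ℝ, ℝ) f x) {df : Model m →L[ℝ] ℝ}
    (hdf : df = mfderiv (𝓡 (m + 1)) 𝓘(ℝ, ℝ) f x) (u : Metric.sphere (0 : Model m) 1) :
    (direction x u).val (lieX F (pull f)) = df (u : Model m) / fiberFun F x u := by
  obtain ⟨c, hc, h⟩ := exists_vec_direction x u
  have hne : (c • (u : Model m) : Model m) ≠ 0 :=
    smul_ne_zero hc.ne' (ne_zero_of_mem_unit_sphere u)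
  rw [HFiber.val, h, hF.lieX_pull (p := ⟨x, (c • (u : Model m) : Model m)⟩) hne hf,
    ← hF.div_fiberFun_smul x df hc, div_eq_inv_mul, hdf]
  rfl

/-- The symbol of `F + β` as an integral of quantities attached to `F` over a half-fibre. -/
theorem integral_halfFiber (hF : IsFinslerMetric F) (hrev : IsReversible F)
    (hF' : IsFinslerMetric (addOneForm F β)) {x : M}
    (hβ : ∀ v : Model m, v ≠ 0 → |modelForm β x v| < fiberFun F x v) (hne : modelForm β x ≠ 0)
    {f : M → ℝ} (hf : MDifferentiableAt (𝓡 (m + 1)) 𝓘(ℝ, ℝ) f x) {df : Model m →L[ℝ] ℝ}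
    (hdf : df = mfderiv (𝓡 (m + 1)) 𝓘(ℝ, ℝ) f x) :
    principalSymbol (bfLaplacian (addOneForm F β)) x df df =
      2 * ((m : ℝ) + 1) / (sphereVol m).toReal *
        ∫ ξ in {ξ : HFiber m x | 0 ≤ ξ.val (oneFormX F β)},
          ξ.val (lieX F (pull f)) ^ 2 / (1 - ξ.val (oneFormX F β) ^ 2) ∂(angleMeasure F x) := by
  -- Here `β(X) = β(u) / F(u)` has the sign of `β(u)`, so the half-fibre corresponds to a
  -- hemisphere.
  have hset : direction x ⁻¹' {ξ : HFiber m x | 0 ≤ ξ.val (oneFormX F β)} =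
      {u : Metric.sphere (0 : Model m) 1 | 0 ≤ modelForm β x (u : Model m)} := by
    ext u
    simp only [Set.mem_preimage, Set.mem_ofPred_eq, val_oneFormX hF]
    rw [le_div_iff₀ (hF.fiberFun_pos x (ne_zero_of_mem_unit_sphere u)), zero_mul]
  have hmeas : MeasurableSet {ξ : HFiber m x | 0 ≤ ξ.val (oneFormX F β)} := by
    change MeasurableSet (direction x ⁻¹' {ξ : HFiber m x | 0 ≤ ξ.val (oneFormX F β)})
    rw [hset]
    exact (isClosed_le continuous_const (continuous_clm_sphere _)).measurableSet
  rw [← integral_indicator hmeas, integral_angleMeasure hF]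
  have hintegral : ∀ u : Metric.sphere (0 : Model m) 1, angleDensity F x u *
      {ξ : HFiber m x | 0 ≤ ξ.val (oneFormX F β)}.indicator (fun ξ =>
        ξ.val (lieX F (pull f)) ^ 2 / (1 - ξ.val (oneFormX F β) ^ 2)) (direction x u) =
      {u : Metric.sphere (0 : Model m) 1 | 0 ≤ modelForm β x (u : Model m)}.indicator
        (symbolIntegrand F β x df) u := by
    intro u
    have hu := ne_zero_of_mem_unit_sphere u
    have hmem := Set.ext_iff.mp hset u
    rw [Set.mem_preimage] at hmem
    by_cases h : u ∈ {u : Metric.sphere (0 : Model m) 1 | 0 ≤ modelForm β x (u : Model m)}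
    · rw [Set.indicator_of_mem h, Set.indicator_of_mem (hmem.mpr h), val_oneFormX hF,
        val_lieX_pull hF x hf hdf, angleDensity_eq, symbolIntegrand]
      have h1 := (hF.fiberFun_pos x hu).ne'
      have h3 : fiberFun F x u ^ 2 - modelForm β x u ^ 2 ≠ 0 := (sq_sub_sq_pos (hβ u hu)).ne'
      have h4 : 1 - (modelForm β x u / fiberFun F x u) ^ 2 =
          (fiberFun F x u ^ 2 - modelForm β x u ^ 2) / fiberFun F x u ^ 2 := by
        field_simp
      rw [h4]
      field_simp
    · rw [Set.indicator_of_notMem h, Set.indicator_of_notMem (fun h' => h (hmem.mp h')), mul_zero]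
  simp_rw [hintegral]
  rw [principalSymbol_addOneForm hF hrev hF' hβ, ← two_mul_integral_halfSphere hne
    (continuous_symbolIntegrand hF hβ df) (symbolIntegrand_neg hrev x df)]
  have h3 := (sphereVol_toReal_pos m).ne'
  field_simp

end Comparison

end BF

end

/-! ### The main theorem -/

theorem mainTheorem6 {m : ℕ} {M : Type*} [TopologicalSpace M] [ChartedSpace (BF.Model m) M]
    [IsManifold (𝓡 (m + 1)) ∞ M]
    (Fbar : TangentBundle (𝓡 (m + 1)) M → ℝ)
    (hF : BF.IsFinslerMetric Fbar) (hrev : BF.IsReversible Fbar)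
    (β : ∀ x : M, TangentSpace (𝓡 (m + 1)) x →L[ℝ] ℝ) (hβ : BF.IsC2OneForm β)
    (hβ1 : ∀ x : M, BF.dualMetric Fbar x (β x) < 1)
    (F : TangentBundle (𝓡 (m + 1)) M → ℝ) (hFdef : F = BF.addOneForm Fbar β)
    (f : M → ℝ) (hf : ContMDiff (𝓡 (m + 1)) 𝓘(ℝ, ℝ) 1 f) (x : M)
    (df : TangentSpace (𝓡 (m + 1)) x →L[ℝ] ℝ)
    (hdf : df = mfderiv (𝓡 (m + 1)) 𝓘(ℝ, ℝ) f x) :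
    BF.symbolNorm Fbar x df ≤ BF.symbolNorm F x df ∧
    (BF.symbolNorm F x df = BF.symbolNorm Fbar x df ↔ df = 0 ∨ β x = 0) ∧
    (β x ≠ 0 →
      BF.symbolNorm F x df ^ 2 =
        2 * ((m : ℝ) + 1) / (BF.sphereVol m).toReal *
          ∫ ξ in {ξ : BF.HFiber m x | 0 ≤ ξ.val (BF.oneFormX Fbar β)},
            ξ.val (BF.lieX Fbar (BF.pull f)) ^ 2 / (1 - ξ.val (BF.oneFormX Fbar β) ^ 2)
              ∂(BF.angleMeasure Fbar x)) := by
  subst hFdef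
  -- The dual norm bounds `β` from above only; reversibility at `-v` supplies the lower bound.
  have habs : ∀ (y : M) (v : BF.Model m), v ≠ 0 →
      |BF.modelForm β y v| < BF.fiberFun Fbar y v := by
    intro y v hv
    have h1 : BF.modelForm β y v < BF.fiberFun Fbar y v := hF.lt_of_dualMetric_lt_one (hβ1 y) hv
    have h2 : BF.modelForm β y (-v) < BF.fiberFun Fbar y (-v) :=
      hF.lt_of_dualMetric_lt_one (hβ1 y) (neg_ne_zero.mpr hv)
    have h3 : BF.fiberFun Fbar y (-v) = BF.fiberFun Fbar y v := hrev y v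
    rw [map_neg, h3] at h2
    exact abs_lt.mpr ⟨by linarith, h1⟩
  have hF' : BF.IsFinslerMetric (BF.addOneForm Fbar β) :=
    hF.addOneForm hβ fun y v hv => by linarith [(abs_lt.mp (habs y v hv)).1]
  have hfx := hf.mdifferentiableAt (x := x) (by norm_num)
  obtain ⟨hle, heq⟩ := BF.principalSymbol_sub hF hrev hF' (habs x) df
  have h0 := BF.principalSymbol_nonneg hF x df
  have h0' := BF.principalSymbol_nonneg hF' x df
  refine ⟨Real.sqrt_le_sqrt hle, (Real.sqrt_inj h0' h0).trans heq, fun hne => ?_⟩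
  exact (Real.sq_sqrt h0').trans (BF.integral_halfFiber hF hrev hF' (habs x) hne hfx hdf)
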